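/- Let $n,k$ be integers with $1\le k\le n+1$, let $\mathbb{R}^{k-1}=\{x\in\mathbb{R}^{n+1}: x_k=\cdots=x_{n+1}=0\}$, let $\mathbb{R}^{n-k+2}$ be its orthogonal complement in $\mathbb{R}^{n+1}$, and let $x^\perp$ denote the component of $x$ in $\mathbb{R}^{n-k+2}$. Let $g_0$ be the Euclidean metric, and let $g=\|x^\perp\|^{-2}g_0$ on $\mathbb{R}^{n+1}\setminus\mathbb{R}^{k-1}$. For an integer $m\ge1$ consider the following two kinds of subsets $S$ of $\mathbb{R}^{n+1}$: (i) the $m$-dimensional affine subspaces $S=x_0+\mathbb{R}^{l-1}\oplus\mathbb{R}^{m-l+1}$, where $1\le l\le k$, $l\le m$, $x_0\in\mathbb{R}^{k-1}$, and $\mathbb{R}^{l-1}\subset\mathbb{R}^{k-1}$, $\mathbb{R}^{m-l+1}\subset\mathbb{R}^{n-k+2}$ are linear subspaces of dimensions $l-1$ and $m-l+1$; (ii) the $m$-dimensional hyperspheres $S=\{x\in A:\|x-c\|=r\}$, $r>0$, of an $(m+1)$-dimensional affine subspace $A=x_0+\mathbb{R}^{l-1}\oplus\mathbb{R}^{m-l+2}$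 as in (i) (with $m+1$ in place of $m$), centred at a point $c\in x_0+\mathbb{R}^{l-1}$. An immersion $f\colon M^m\to\mathbb{R}^{n+1}\setminus\mathbb{R}^{k-1}$ of a smooth manifold, where $M$ carries the metric induced by $g$, is called totally geodesic if its second fundamental form with respect to $g$ vanishes identically. Then: (a) If $m\ge 2$, $M^m$ is connected and $f\colon M^m\to(\mathbb{R}^{n+1}\setminus\mathbb{R}^{k-1},g)$ is a totally geodesic immersion, then $f(M)$ is an open subset of some $S$ of kind (i) or (ii). (b) Conversely, every immersion $f\colon M^m\to(\mathbb{R}^{n+1}\setminus\mathbb{R}^{k-1},g)$ whose image is contained in some ($m$-dimensional) $S$ of kind (i) or (ii) is totally geodesic. (c) For every $S$ of kind (i) or (ii), $S\setminus\mathbb{R}^{k-1}$ is a nonempty embedded $m$-dimensional totally geodesic submanifold of $(\mathbb{R}^{n+1}\setminus\mathbb{R}^{k-1},g)$. -/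

import Mathlib

open scoped ContDiff Manifold

noncomputable section

/-! ### Riemannian geometry in the global chart of a vector space `E`

A metric on a region of `E` is a function `g` that sends a point to a bilinear form on `E`
(the tangent space at that point). -/

section Riemannian

variable {E : Type*} [NormedAddCommGroup E] [NormedSpace ℝ E]

/-- The Christoffel symbols of the first kind, as a functional:
`w ↦ (∂_u g(v, w) + ∂_v g(u, w) - ∂_w g(u, v)) / 2` at the point `x`. -/
def christoffelLower (g : E → E →L[ℝ] E →L[ℝ] ℝ) (x u v : E) : E →L[ℝ] ℝ :=
  (1 / 2 : ℝ) •
    (fderiv ℝ g x u v + fderiv ℝ g x v u - ((fderiv ℝ g x).flip u).flip v)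

theorem christoffelLower_apply (g : E → E →L[ℝ] E →L[ℝ] ℝ) (x u v w : E) :
    christoffelLower g x u v w =
      (1 / 2 : ℝ) * (fderiv ℝ g x u v w + fderiv ℝ g x v u w - fderiv ℝ g x w u v) := by
  simp [christoffelLower]

/-- The Christoffel symbols of the second kind of the Levi-Civita connection of `g`: the vector
`Γ(u, v)` with `g_x(Γ(u, v), w) = christoffelLower g x u v w` for all `w`, so that
`∇_u V = ∂_u V + Γ(u, V)`. -/
def christoffel (g : E → E →L[ℝ] E →L[ℝ] ℝ) (x u v : E) : E :=
  (g x).inverse (christoffelLower g x u v)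

/-- Where `g` is positive definite, `christoffel` solves its defining equation. -/
theorem christoffel_spec [FiniteDimensional ℝ E] (g : E → E →L[ℝ] E →L[ℝ] ℝ) (x : E)
    (hg : ∀ u, u ≠ 0 → 0 < g x u u) (u v w : E) :
    g x (christoffel g x u v) w = christoffelLower g x u v w := by
  have hinj : Function.Injective (g x : E →ₗ[ℝ] (E →L[ℝ] ℝ)) := by
    rw [injective_iff_map_eq_zero]
    intro a ha
    by_contra h
    have h1 := hg a h
    have h2 : g x a = 0 := ha
    rw [h2] at h1
    simp at h1
  have hfin : Module.finrank ℝ E = Module.finrank ℝ (E →L[ℝ] ℝ) := by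
    rw [← (LinearMap.toContinuousLinearMap : (E →ₗ[ℝ] ℝ) ≃ₗ[ℝ] (E →L[ℝ] ℝ)).finrank_eq]
    exact (Subspace.dual_finrank_eq (K := ℝ) (V := E)).symm
  let e : E ≃L[ℝ] (E →L[ℝ] ℝ) :=
    (LinearEquiv.ofInjectiveOfFinrankEq (g x : E →ₗ[ℝ] (E →L[ℝ] ℝ)) hinj
      hfin).toContinuousLinearEquiv
  have he : g x = (e : E →L[ℝ] (E →L[ℝ] ℝ)) := by
    ext a b; rfl
  unfold christoffel
  rw [he, ContinuousLinearMap.inverse_equiv]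
  simp

/-- The orthogonal complement of a subspace `T` with respect to a bilinear form `b`. -/
def normalSpace (b : E →L[ℝ] E →L[ℝ] ℝ) (T : Submodule ℝ E) : Submodule ℝ E where
  carrier := {z | ∀ t ∈ T, b t z = 0}
  add_mem' := by
    intro a c ha hc t ht
    simp [ha t ht, hc t ht]
  zero_mem' := by
    intro t _
    simp
  smul_mem' := by
    intro r a ha t ht
    simp [ha t ht]

open Classical in
/-- The component of `z` in `normalSpace b T` along `E = normalSpace b T ⊕ T`. -/
def normalPart (b : E →L[ℝ] E →L[ℝ] ℝ) (T : Submodule ℝ E) (z : E) : E :=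
  if h : IsCompl (normalSpace b T) T then (normalSpace b T).projection T h z else 0

/-- For a positive definite form the decomposition used in `normalPart` exists. -/
theorem isCompl_normalSpace [FiniteDimensional ℝ E] (b : E →L[ℝ] E →L[ℝ] ℝ)
    (hsymm : ∀ u v, b u v = b v u) (hb : ∀ u, u ≠ 0 → 0 < b u u) (T : Submodule ℝ E) :
    IsCompl (normalSpace b T) T := by
  let B : LinearMap.BilinForm ℝ E :=
    LinearMap.mk₂ ℝ (fun u v => b u v) (by simp) (by simp) (by simp) (by simp)
  have hB : ∀ u v, B u v = b u v := fun _ _ => rfl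
  have hrefl : B.IsRefl := by
    intro u v h
    rw [hB] at h ⊢
    rw [hsymm, h]
  have hN : B.orthogonal T = normalSpace b T := by
    ext z
    exact Iff.rfl
  have hd : Disjoint T (B.orthogonal T) := by
    rw [Submodule.disjoint_def]
    intro a ha ha'
    by_contra h
    exact absurd (ha' a ha) (hb a h).ne'
  rw [← hN]
  exact ((LinearMap.BilinForm.isCompl_orthogonal_iff_disjoint hrefl).2 hd).symm

variable (m : ℕ) {M : Type*} [TopologicalSpace M] [ChartedSpace (EuclideanSpace ℝ (Fin m)) M]

/-- A smooth map whose differential is injective at every point. -/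
def IsSmoothImmersion (f : M → E) : Prop :=
  ContMDiff (𝓡 m) 𝓘(ℝ, E) ∞ f ∧
    ∀ p : M, Function.Injective (mfderiv (𝓡 m) 𝓘(ℝ, E) f p)

/-- The map `f` read in the chart of `M` at the point `p`. -/
def localRep (f : M → E) (p : M) : EuclideanSpace ℝ (Fin m) → E :=
  f ∘ (extChartAt (𝓡 m) p).symm

/-- The second fundamental form `α_f(u, v) = (∇_X f_* Y)^⊥` at `p` of an immersion `f` of a
manifold `M`, with the metric induced by `f`, into a region of `E` with the metric `g`. The vectors
`u, v` are tangent vectors of `M` at `p`, written in the coordinates of the chart of `M` at `p`,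
and `X, Y` are the vector fields with the constant coordinates `u, v`. With `F` the map `f` in that
chart, `∇_X f_* Y = D²F(u, v) + Γ(DF u, DF v)`; the normal part is taken with respect to `g`. -/
def secondFundamentalForm (g : E → E →L[ℝ] E →L[ℝ] ℝ) (f : M → E) (p : M)
    (u v : EuclideanSpace ℝ (Fin m)) : E :=
  let F := localRep m f p
  let y := extChartAt (𝓡 m) p p
  normalPart (g (f p)) (LinearMap.range (fderiv ℝ F y : EuclideanSpace ℝ (Fin m) →ₗ[ℝ] E))
    (fderiv ℝ (fderiv ℝ F) y u v + christoffel g (f p) (fderiv ℝ F y u) (fderiv ℝ F y v))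

/-- The second fundamental form vanishes identically. -/
def IsTotallyGeodesic (g : E → E →L[ℝ] E →L[ℝ] ℝ) (f : M → E) : Prop :=
  ∀ (p : M) (u v : EuclideanSpace ℝ (Fin m)), secondFundamentalForm m g f p u v = 0

end Riemannian

/-! ### The conformal model -/

/-- The subspace `ℝ^{k-1} = {x | x_k = ⋯ = x_{n+1} = 0}` of `ℝ^{n+1}`. The coordinate `x_j` is
`x i` with `j = i + 1`. -/
def axis (n k : ℕ) : Submodule ℝ (EuclideanSpace ℝ (Fin (n + 1))) where
  carrier := {x | ∀ i : Fin (n + 1), k ≤ (i : ℕ) + 1 → x i = 0}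
  add_mem' := by
    intro a b ha hb i hi
    simp [ha i hi, hb i hi]
  zero_mem' := by
    intro i _
    simp
  smul_mem' := by
    intro r a ha i hi
    simp [ha i hi]

/-- The metric `g = ‖x^⊥‖⁻² g₀` on `ℝ^{n+1} ∖ ℝ^{k-1}`, with `g₀` the Euclidean metric and `x^⊥` the
component of `x` orthogonal to `ℝ^{k-1}`. -/
def modelMetric (n k : ℕ) (x : EuclideanSpace ℝ (Fin (n + 1))) :
    EuclideanSpace ℝ (Fin (n + 1)) →L[ℝ] EuclideanSpace ℝ (Fin (n + 1)) →L[ℝ] ℝ :=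
  ((‖(axis n k)ᗮ.starProjection x‖⁻¹) ^ 2) • innerSL ℝ

theorem modelMetric_apply (n k : ℕ) (x u v : EuclideanSpace ℝ (Fin (n + 1))) :
    modelMetric n k x u v = (‖(axis n k)ᗮ.starProjection x‖⁻¹) ^ 2 * inner ℝ u v := by
  simp only [modelMetric, smul_apply, smul_eq_mul]
  rfl

theorem modelMetric_pos (n k : ℕ) {x : EuclideanSpace ℝ (Fin (n + 1))} (hx : x ∉ axis n k)
    (u : EuclideanSpace ℝ (Fin (n + 1))) (hu : u ≠ 0) : 0 < modelMetric n k x u u := by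
  rw [modelMetric_apply, real_inner_self_eq_norm_sq]
  have h : (axis n k)ᗮ.starProjection x ≠ 0 := by
    intro h
    rw [Submodule.starProjection_apply_eq_zero_iff, Submodule.orthogonal_orthogonal] at h
    exact hx h
  positivity

/-- `A` is an affine subspace `x₀ + ℝ^{l-1} ⊕ ℝ^{d-l+1}` of dimension `d`, and `C` is its affine
subspace `x₀ + ℝ^{l-1}`. Here `x₀ ∈ ℝ^{k-1}`, `1 ≤ l ≤ k`, and `ℝ^{l-1}`, `ℝ^{d-l+1}` are linear
subspaces of `ℝ^{k-1}` and of its orthogonal complement. The condition `l ≤ d` says that `A` is not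
contained in `ℝ^{k-1}`. -/
def IsSplitAffineSubspace (n k d : ℕ)
    (A C : AffineSubspace ℝ (EuclideanSpace ℝ (Fin (n + 1)))) : Prop :=
  ∃ l : ℕ, 1 ≤ l ∧ l ≤ k ∧ l ≤ d ∧
    ∃ x₀ ∈ axis n k, ∃ V₁ ≤ axis n k, ∃ V₂ ≤ (axis n k)ᗮ,
      Module.finrank ℝ V₁ = l - 1 ∧ Module.finrank ℝ V₂ = d - l + 1 ∧
      A = AffineSubspace.mk' x₀ (V₁ ⊔ V₂) ∧ C = AffineSubspace.mk' x₀ V₁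

/-- The `m`-dimensional affine subspaces `x₀ + ℝ^{l-1} ⊕ ℝ^{m-l+1}`. -/
def IsModelAffine (n k m : ℕ) (S : Set (EuclideanSpace ℝ (Fin (n + 1)))) : Prop :=
  ∃ A C, IsSplitAffineSubspace n k m A C ∧ S = A

/-- The `m`-dimensional hyperspheres of the `(m+1)`-dimensional affine subspaces
`x₀ + ℝ^{l-1} ⊕ ℝ^{m-l+2}`, centred at a point of `x₀ + ℝ^{l-1}`. -/
def IsModelSphere (n k m : ℕ) (S : Set (EuclideanSpace ℝ (Fin (n + 1)))) : Prop :=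
  ∃ A C, IsSplitAffineSubspace n k (m + 1) A C ∧
    ∃ c ∈ C, ∃ r : ℝ, 0 < r ∧ S = (A : Set (EuclideanSpace ℝ (Fin (n + 1)))) ∩ Metric.sphere c r

end

/-! ### A Grönwall lemma for maps between normed spaces. -/

section LocalGeometry

open Filter Topology

/-! Write `K` for ℝ^{k-1}, P for the projection onto its orthogonal complement and q(x) = Px/‖Px‖²
(`axialField`). The conformal factor gives Γ(u,v) = ⟨u,v⟩q − ⟨q,u⟩v − ⟨q,v⟩u. The last two terms are
tangential along f, so total geodesy says that D²F(u,v) + ⟨DF u, DF v⟩q lies in T = range DF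
(`IsGeodesicAt`).

Differentiating this equation and using the symmetry of D³F, a Codazzi argument, gives Pt − ⟨q,t⟩Px
∈ T for t ∈ T (`starProjection_fderiv_sub_mem_range`). This is where m ≥ 2 enters. Geometrically g
is the product metric of hyperbolic k-space and a round sphere, t ↦ Pt − ⟨q,t⟩Px projects onto the
spherical factor, and so T splits along the product.

If Px ∈ T, then T is P-invariant and the candidate for S is x − Px + T. Otherwise W = T + ℝPx is
P-invariant, and some c in `K` has x − c ∈ W normal to T (`exists_center`); the candidate is the
sphere about c through x in c + W. The defect of first order contact with the candidate satisfies a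
homogeneous linear differential inequality, so contact at one point persists nearby by Grönwall
(`eventually_sub_mem`, `eventually_norm_sub_eq`) and everywhere by connectedness
(`IsSmoothImmersion.forall_mem_of_contact`). Equality of dimensions then makes the image open in S.

For the converse, D²F and q both lie in the P-invariant direction W, and on spheres ⟨x − c, q⟩ = 1
gives the missing orthogonality. The examples are pieces of ℝ^m and of the unit sphere, to which the
converse applies. -/

theorem eventually_eq_zero_of_norm_fderiv_le {D V : Type*} [NormedAddCommGroup D] [NormedSpace ℝ D]
    [NormedAddCommGroup V] [NormedSpace ℝ V] {Z : D → V} {y : D} {C : ℝ}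
    (hd : ∀ᶠ z in 𝓝 y, DifferentiableAt ℝ Z z)
    (hC : ∀ᶠ z in 𝓝 y, ∀ v, ‖fderiv ℝ Z z v‖ ≤ C * ‖Z z‖ * ‖v‖) (h0 : Z y = 0) :
    ∀ᶠ z in 𝓝 y, Z z = 0 := by
  obtain ⟨ε, hε, hb⟩ := Metric.eventually_nhds_iff_ball.1 (hd.and hC)
  refine Metric.eventually_nhds_iff_ball.2 ⟨ε, hε, fun z hz => ?_⟩
  have hseg : ∀ t ∈ Set.Icc (0 : ℝ) 1, y + t • (z - y) ∈ Metric.ball y ε := by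
    intro t ht
    rw [Metric.mem_ball, dist_eq_norm] at hz ⊢
    rw [add_sub_cancel_left, norm_smul, Real.norm_of_nonneg ht.1]
    exact lt_of_le_of_lt (mul_le_of_le_one_left (norm_nonneg _) ht.2) hz
  have hder : ∀ t ∈ Set.Icc (0 : ℝ) 1, HasDerivAt (fun t : ℝ => Z (y + t • (z - y)))
      (fderiv ℝ Z (y + t • (z - y)) (z - y)) t := by
    intro t ht
    have h1 : HasDerivAt (fun t : ℝ => y + t • (z - y)) (z - y) t := by
      simpa using ((hasDerivAt_id t).smul_const (z - y)).const_add y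
    exact (hb _ (hseg t ht)).1.hasFDerivAt.comp_hasDerivAt t h1
  -- One-dimensional Grönwall along the segment from `y` to `z`, whose velocity is `z - y`.
  have := eq_zero_of_abs_deriv_le_mul_abs_self_of_eq_zero_right (a := 0) (b := 1)
    (K := C * ‖z - y‖)
    (fun t ht => (hder t ht).continuousAt.continuousWithinAt)
    (fun t ht => (hder t (Set.Ico_subset_Icc_self ht)).hasDerivWithinAt) (by simpa using h0)
    (fun t ht => ((hb _ (hseg t (Set.Ico_subset_Icc_self ht))).2 _).trans_eq (by ring)) 1 (by simp)
  simpa using this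

/-! ### The differential equation of a totally geodesic map. -/

variable {D E : Type*} [NormedAddCommGroup D] [InnerProductSpace ℝ D] [FiniteDimensional ℝ D]
  [NormedAddCommGroup E] [InnerProductSpace ℝ E] [FiniteDimensional ℝ E]

/-- The inversion `x^⊥ / ‖x^⊥‖²` of the component of `x` orthogonal to `K`. -/
noncomputable def axialField (K : Submodule ℝ E) (x : E) : E :=
  (‖Kᗮ.starProjection x‖ ^ 2)⁻¹ • Kᗮ.starProjection x

/-- The differential equation of a totally geodesic map for the metric `‖x^⊥‖⁻² g₀`. -/
def IsGeodesicAt (K : Submodule ℝ E) (F : D → E) (y : D) : Prop :=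
  ∀ u v, fderiv ℝ (fderiv ℝ F) y u v +
    inner ℝ (fderiv ℝ F y u) (fderiv ℝ F y v) • axialField K (F y) ∈
      LinearMap.range (fderiv ℝ F y : D →ₗ[ℝ] E)

theorem contDiffAt_axialField (K : Submodule ℝ E) {x : E} (hx : Kᗮ.starProjection x ≠ 0) :
    ContDiffAt ℝ ∞ (axialField K) x := by
  unfold axialField
  have h : ContDiffAt ℝ ∞ (fun x => Kᗮ.starProjection x) x := Kᗮ.starProjection.contDiff.contDiffAt
  exact ((h.norm_sq ℝ).inv (by positivity)).smul h

theorem hasFDerivAt_inv_norm_sq_starProjection (K : Submodule ℝ E) {x : E}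
    (hx : Kᗮ.starProjection x ≠ 0) :
    HasFDerivAt (fun x => (‖Kᗮ.starProjection x‖ ^ 2)⁻¹)
      ((-(2 * ((‖Kᗮ.starProjection x‖ ^ 2)⁻¹) ^ 2)) • innerSL ℝ (Kᗮ.starProjection x)) x := by
  have h1 := (Kᗮ.starProjection.hasFDerivAt (x := x)).norm_sq
  have h2 := (hasDerivAt_inv (by positivity : ‖Kᗮ.starProjection x‖ ^ 2 ≠ 0)).comp_hasFDerivAt x h1
  refine h2.congr_fderiv ?_
  ext u
  have h3 : (inner ℝ (Kᗮ.starProjection x) (Kᗮ.starProjection u) : ℝ) =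
      inner ℝ (Kᗮ.starProjection x) u := by
    rw [← Submodule.inner_starProjection_left_eq_right,
      Submodule.starProjection_eq_self_iff.2 (Submodule.starProjection_apply_mem _ _)]
  simp only [smul_apply, ContinuousLinearMap.comp_apply, innerSL_apply_apply, h3, smul_eq_mul,
    nsmul_eq_mul]
  push_cast
  ring

theorem fderiv_axialField_apply (K : Submodule ℝ E) {x : E} (hx : Kᗮ.starProjection x ≠ 0) (u : E) :
    fderiv ℝ (axialField K) x u = (‖Kᗮ.starProjection x‖ ^ 2)⁻¹ • Kᗮ.starProjection u -
      (2 * inner ℝ (axialField K x) u) • axialField K x := by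
  have h := (hasFDerivAt_inv_norm_sq_starProjection K hx).smul
    (Kᗮ.starProjection.hasFDerivAt (x := x))
  have h' : fderiv ℝ (axialField K) x = _ := h.fderiv
  rw [h']
  simp only [axialField, add_apply, smul_apply, ContinuousLinearMap.smulRight_apply,
    innerSL_apply_apply, inner_smul_left, smul_smul, sub_eq_add_neg, ← neg_smul]
  simp
  ring_nf

/-- Turns membership in the range into an equation that can be differentiated. A fixed left inverse
`A` of the differential at `y` stays invertible after composition with nearby differentials, so (A
DF)⁻¹A recovers the preimage of a tangent vector, differentiably in the base point. -/
theorem exists_tangential_coefficients {K : Submodule ℝ E} {F : D → E} {y : D}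
    (hF : ContDiffAt ℝ ∞ F y) (hinj : Function.Injective (fderiv ℝ F y))
    (hy : Kᗮ.starProjection (F y) ≠ 0) (hg : ∀ᶠ z in 𝓝 y, IsGeodesicAt K F z) :
    ∃ Γ : D → D → D → D, (∀ u v, DifferentiableAt ℝ (Γ u v) y) ∧
      (∃ C, 0 ≤ C ∧ ∀ᶠ z in 𝓝 y, ∀ u v, ‖Γ u v z‖ ≤ C * ‖u‖ * ‖v‖) ∧
      ∀ᶠ z in 𝓝 y, ∀ u v, fderiv ℝ (fderiv ℝ F) z u v =
        fderiv ℝ F z (Γ u v z) -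
          (inner ℝ (fderiv ℝ F z u) (fderiv ℝ F z v) : ℝ) • axialField K (F z) := by
  obtain ⟨A₀, hA₀⟩ := (fderiv ℝ F y : D →ₗ[ℝ] E).exists_leftInverse_of_injective
    (LinearMap.ker_eq_bot.2 hinj)
  let A : E →L[ℝ] D := LinearMap.toContinuousLinearMap A₀
  have hA : A ∘L fderiv ℝ F y = 1 := by
    ext u
    exact LinearMap.congr_fun hA₀ u
  have hF1 : ContDiffAt ℝ ∞ (fderiv ℝ F) y := hF.fderiv_right (by simp)
  have hF2 : ContDiffAt ℝ ∞ (fderiv ℝ (fderiv ℝ F)) y := hF1.fderiv_right (by simp)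
  have hq : ContDiffAt ℝ ∞ (fun z => axialField K (F z)) y :=
    (contDiffAt_axialField K hy).comp y hF
  have hAF : ContDiffAt ℝ ∞ (fun z => A ∘L fderiv ℝ F z) y := contDiffAt_const.clm_comp hF1
  have hinv : ContDiffAt ℝ ∞ (fun z => Ring.inverse (A ∘L fderiv ℝ F z)) y := by
    refine ContDiffAt.comp y (g := Ring.inverse) ?_ hAF
    rw [hA]
    exact contDiffAt_ringInverse ℝ (1 : (D →L[ℝ] D)ˣ)
  have hunit : ∀ᶠ z in 𝓝 y, IsUnit (A ∘L fderiv ℝ F z) := by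
    refine hAF.continuousAt.eventually (Units.isOpen.mem_nhds ?_)
    change IsUnit (A ∘L fderiv ℝ F y)
    rw [hA]
    exact isUnit_one
  let B : D → ℝ := fun z => ‖Ring.inverse (A ∘L fderiv ℝ F z)‖ * (‖A‖ *
    (‖fderiv ℝ (fderiv ℝ F) z‖ + ‖fderiv ℝ F z‖ * ‖fderiv ℝ F z‖ * ‖axialField K (F z)‖))
  have hB : ContinuousAt B y := by
    have h1 := hinv.continuousAt
    have h2 := hF1.continuousAt
    have h3 := hF2.continuousAt
    have h4 := hq.continuousAt
    have n3 : ContinuousAt (fun z => ‖fderiv ℝ (fderiv ℝ F) z‖) y :=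
      (continuous_norm (E := D →L[ℝ] D →L[ℝ] E)).continuousAt.comp h3
    have h5 := n3.add ((h2.norm.mul h2.norm).mul h4.norm)
    exact h1.norm.mul ((continuousAt_const (y := ‖A‖)).mul h5)
  refine ⟨fun u v z => Ring.inverse (A ∘L fderiv ℝ F z) (A (fderiv ℝ (fderiv ℝ F) z u v +
    (inner ℝ (fderiv ℝ F z u) (fderiv ℝ F z v) : ℝ) • axialField K (F z))), ?_, ?_, ?_⟩
  · intro u v
    have h1 := hinv.differentiableAt (by simp)
    have h2 := hF1.differentiableAt (by simp)
    have h3 := hF2.differentiableAt (by simp)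
    have h4 := hq.differentiableAt (by simp)
    have h5 : DifferentiableAt ℝ
        (fun z => (inner ℝ (fderiv ℝ F z u) (fderiv ℝ F z v) : ℝ)) y :=
      (h2.clm_apply (differentiableAt_const u)).inner ℝ (h2.clm_apply (differentiableAt_const v))
    fun_prop
  · refine ⟨B y + 1, by positivity, ?_⟩
    filter_upwards [hB.eventually (gt_mem_nhds (lt_add_one (B y)))] with z hz u v
    have h1 : ‖fderiv ℝ (fderiv ℝ F) z u v +
        (inner ℝ (fderiv ℝ F z u) (fderiv ℝ F z v) : ℝ) • axialField K (F z)‖ ≤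
        (‖fderiv ℝ (fderiv ℝ F) z‖ + ‖fderiv ℝ F z‖ * ‖fderiv ℝ F z‖ * ‖axialField K (F z)‖) *
          (‖u‖ * ‖v‖) := by
      refine (norm_add_le _ _).trans ?_
      rw [add_mul, norm_smul]
      refine add_le_add (((fderiv ℝ (fderiv ℝ F) z).le_opNorm₂ u v).trans_eq (by ring)) ?_
      have h3 := (norm_inner_le_norm (𝕜 := ℝ) (fderiv ℝ F z u) (fderiv ℝ F z v)).trans
        (mul_le_mul ((fderiv ℝ F z).le_opNorm u) ((fderiv ℝ F z).le_opNorm v) (norm_nonneg _)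
          (by positivity))
      refine (mul_le_mul_of_nonneg_right h3 (norm_nonneg _)).trans_eq (by ring)
    calc _ ≤ ‖Ring.inverse (A ∘L fderiv ℝ F z)‖ * (‖A‖ * _) :=
          (ContinuousLinearMap.le_opNorm _ _).trans
            (mul_le_mul_of_nonneg_left ((ContinuousLinearMap.le_opNorm _ _).trans
              (mul_le_mul_of_nonneg_left h1 (norm_nonneg _))) (norm_nonneg _))
      _ = B z * (‖u‖ * ‖v‖) := by simp only [B]; ring
      _ ≤ (B y + 1) * (‖u‖ * ‖v‖) := by gcongr
      _ = _ := by ring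
  · filter_upwards [hg, hunit] with z hz hu u v
    obtain ⟨t, ht⟩ := hz u v
    rw [ContinuousLinearMap.coe_coe] at ht
    have h1 : Ring.inverse (A ∘L fderiv ℝ F z) (A (fderiv ℝ F z t)) = t :=
      congrArg (fun L : D →L[ℝ] D => L t) (Ring.inverse_mul_cancel _ hu)
    rw [← ht, h1, ht, add_sub_cancel_right]

/-! ### The integrability condition on the tangent space. -/

omit [FiniteDimensional ℝ E] in
theorem exists_ne_zero_inner_eq_zero (L : D →L[ℝ] E) (hD : 1 < Module.finrank ℝ D) (u : D) :
    ∃ v, v ≠ 0 ∧ (inner ℝ (L v) (L u) : ℝ) = 0 := by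
  let φ : D →ₗ[ℝ] ℝ := (innerSL ℝ (L u) ∘L L : D →L[ℝ] ℝ)
  have h : LinearMap.ker φ ≠ ⊥ := LinearMap.ker_ne_bot_of_finrank_lt (by simpa using hD)
  obtain ⟨v, hv, hv0⟩ := Submodule.exists_mem_ne_zero_of_ne_bot h
  refine ⟨v, hv0, ?_⟩
  rw [real_inner_comm]
  exact hv

theorem starProjection_fderiv_sub_mem_range {K : Submodule ℝ E} {F : D → E} {y : D}
    (hD : 1 < Module.finrank ℝ D)
    (hF : ContDiffAt ℝ ∞ F y) (hinj : Function.Injective (fderiv ℝ F y))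
    (hy : Kᗮ.starProjection (F y) ≠ 0) (hg : ∀ᶠ z in 𝓝 y, IsGeodesicAt K F z) (u : D) :
    Kᗮ.starProjection (fderiv ℝ F y u) -
      (inner ℝ (axialField K (F y)) (fderiv ℝ F y u) : ℝ) • Kᗮ.starProjection (F y) ∈
        LinearMap.range (fderiv ℝ F y : D →ₗ[ℝ] E) := by
  obtain ⟨Γ, hΓ, -, hE⟩ := exists_tangential_coefficients hF hinj hy hg
  have hF1 : ContDiffAt ℝ ∞ (fderiv ℝ F) y := hF.fderiv_right (by simp)
  have hF2 : ContDiffAt ℝ ∞ (fderiv ℝ (fderiv ℝ F)) y := hF1.fderiv_right (by simp)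
  have hd0 := (hF.differentiableAt (by simp)).hasFDerivAt
  have hd1 := (hF1.differentiableAt (by simp)).hasFDerivAt
  have hd2 := (hF2.differentiableAt (by simp)).hasFDerivAt
  have hq : HasFDerivAt (fun z => axialField K (F z)) _ y :=
    (((contDiffAt_axialField K hy).differentiableAt (by simp)).hasFDerivAt).comp y hd0
  have h2 : minSmoothness ℝ 2 ≤ (∞ : WithTop ℕ∞) := by
    rw [minSmoothness_of_isRCLikeNormedField]
    exact WithTop.coe_le_coe.2 le_top
  have hsymm : ∀ v w, fderiv ℝ (fderiv ℝ F) y v w = fderiv ℝ (fderiv ℝ F) y w v :=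
    fun v w => (hF.isSymmSndFDerivAt h2) v w
  have hsymm' : ∀ v w, fderiv ℝ (fderiv ℝ (fderiv ℝ F)) y v w =
      fderiv ℝ (fderiv ℝ (fderiv ℝ F)) y w v :=
    fun v w => (hF1.isSymmSndFDerivAt h2) v w
  have hEy := hE.self_of_nhds
  set L := fderiv ℝ F y with hL
  set q := axialField K (F y) with hq0
  have key : ∀ u v w, fderiv ℝ (fderiv ℝ (fderiv ℝ F)) y w u v =
      L (fderiv ℝ (Γ u v) y w) + fderiv ℝ (fderiv ℝ F) y w (Γ u v y) -
      ((inner ℝ (L u) (L v) : ℝ) • fderiv ℝ (axialField K) (F y) (L w) +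
        (inner ℝ (L u) (fderiv ℝ (fderiv ℝ F) y w v) +
          inner ℝ (fderiv ℝ (fderiv ℝ F) y w u) (L v) : ℝ) • q) := by
    intro u v w
    have h1 := (hd2.clm_apply (hasFDerivAt_const u y)).clm_apply (hasFDerivAt_const v y)
    have hi := (hd1.clm_apply (hasFDerivAt_const u y)).inner ℝ
      (hd1.clm_apply (hasFDerivAt_const v y))
    have h2 := (hd1.clm_apply (hΓ u v).hasFDerivAt).sub (hi.smul hq)
    have h3 := h1.congr_of_eventuallyEq (hE.mono fun z hz => (hz u v).symm)
    have h4 := congrArg (fun T : D →L[ℝ] E => T w) (h3.unique h2)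
    simpa using h4
  obtain ⟨v, hv0, hv⟩ := exists_ne_zero_inner_eq_zero L hD u
  have hv' : (inner ℝ (L u) (L v) : ℝ) = 0 := by rw [real_inner_comm]; exact hv
  have hLv : (inner ℝ (L v) (L v) : ℝ) ≠ 0 := by
    rw [inner_self_ne_zero]
    intro h
    exact hv0 (hinj (h.trans (map_zero L).symm))
  have hphi : (‖Kᗮ.starProjection (F y)‖ ^ 2) ≠ 0 := by positivity
  -- Compare D³F(v;u,v) with D³F(u;v,v) for ⟨Lu, Lv⟩ = 0. Modulo T, only ⟨Lv, Lv⟩ Dq(Lu) and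
  -- multiples of q survive; all q-terms containing Γ cancel. Dividing by ⟨Lv, Lv⟩ and multiplying
  -- by ‖Px‖² explains the witness below.
  have e := key u v v
  rw [hsymm' v u, key v v u] at e
  simp only [hEy, inner_sub_left, inner_sub_right, inner_smul_left, inner_smul_right, hv, hv',
    fderiv_axialField_apply K hy] at e
  rw [← hq0] at e
  have hs : L (Γ v u y) = L (Γ u v y) := by
    have := hsymm u v
    rw [hEy, hEy, hv, hv', zero_smul, sub_zero, sub_zero] at this
    exact this.symm
  have hφq : Kᗮ.starProjection (F y) = (‖Kᗮ.starProjection (F y)‖ ^ 2) • q := by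
    rw [hq0, axialField, smul_smul, mul_inv_cancel₀ hphi, one_smul]
  rw [hs, real_inner_comm (L v) (L (Γ u v y)), real_inner_comm q (L u), map_zero] at e
  refine ⟨(‖Kᗮ.starProjection (F y)‖ ^ 2 * (inner ℝ (L v) (L v) : ℝ)⁻¹) •
    (fderiv ℝ (Γ v v) y u + Γ u (Γ v v y) y - fderiv ℝ (Γ u v) y v - Γ v (Γ u v y) y), ?_⟩
  have e' : L (fderiv ℝ (Γ v v) y u + Γ u (Γ v v y) y - fderiv ℝ (Γ u v) y v - Γ v (Γ u v y) y) =
      (inner ℝ (L v) (L v) : ℝ) • ((‖Kᗮ.starProjection (F y)‖ ^ 2)⁻¹ • Kᗮ.starProjection (L u) -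
        (inner ℝ q (L u) : ℝ) • q) := by
    simp only [map_add, map_sub]
    linear_combination (norm := module) e
  rw [ContinuousLinearMap.coe_coe, map_smul, e', smul_smul, mul_assoc, inv_mul_cancel₀ hLv, mul_one,
    smul_sub, smul_smul, mul_inv_cancel₀ hphi, one_smul, smul_comm, ← hφq]

/-! ### The centre of the candidate sphere. -/

theorem starProjection_orthogonal_eq_zero_iff {K : Submodule ℝ E} {x : E} :
    Kᗮ.starProjection x = 0 ↔ x ∈ K := by
  rw [Submodule.starProjection_apply_eq_zero_iff, Submodule.orthogonal_orthogonal]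

theorem inner_starProjection_self (K : Submodule ℝ E) (x y : E) :
    (inner ℝ (K.starProjection x) (K.starProjection y) : ℝ) = inner ℝ (K.starProjection x) y := by
  rw [← Submodule.inner_starProjection_left_eq_right,
    Submodule.starProjection_eq_self_iff.2 (Submodule.starProjection_apply_mem _ _)]

/-- A self-adjoint operator preserving `W` also preserves its orthogonal complement. -/
theorem starProjection_comm_of_invariant {K W : Submodule ℝ E}
    (hW : ∀ w ∈ W, K.starProjection w ∈ W) (x : E) :
    Wᗮ.starProjection (K.starProjection x) = K.starProjection (Wᗮ.starProjection x) := by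
  have h1 : Wᗮ.starProjection (K.starProjection (W.starProjection x)) = 0 :=
    starProjection_orthogonal_eq_zero_iff.2 (hW _ (Submodule.starProjection_apply_mem _ _))
  have h2 : K.starProjection (Wᗮ.starProjection x) ∈ Wᗮ := by
    rw [Submodule.mem_orthogonal]
    intro w hw
    rw [← Submodule.inner_starProjection_left_eq_right]
    exact Submodule.inner_right_of_mem_orthogonal (hW w hw) (Submodule.starProjection_apply_mem _ _)
  conv_lhs => rw [← W.starProjection_add_starProjection_orthogonal x]
  rw [map_add, map_add, h1, zero_add, Submodule.starProjection_eq_self_iff.2 h2]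

/-- The centre of the sphere through `x` tangent to `T`. -/
theorem exists_center {K T : Submodule ℝ E} {x : E}
    (hT : ∀ t ∈ T, Kᗮ.starProjection t - (inner ℝ (axialField K x) t : ℝ) • Kᗮ.starProjection x ∈ T)
    (hw : Kᗮ.starProjection x ∉ T) :
    ∃ c ∈ K, x ≠ c ∧ x - c ∈ T ⊔ Submodule.span ℝ {Kᗮ.starProjection x} ∧
      ∀ t ∈ T, (inner ℝ (x - c) t : ℝ) = 0 := by
  have hin : ∀ t, (inner ℝ (axialField K x) t : ℝ) =
      (‖Kᗮ.starProjection x‖ ^ 2)⁻¹ * inner ℝ (Kᗮ.starProjection x) t := by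
    intro t
    rw [axialField, inner_smul_left]
    rfl
  simp only [hin] at hT
  have hself : ∀ t, (inner ℝ (Kᗮ.starProjection x) (Kᗮ.starProjection t) : ℝ) =
    inner ℝ (Kᗮ.starProjection x) t := inner_starProjection_self _ _
  have hPw : Kᗮ.starProjection (Kᗮ.starProjection x) = Kᗮ.starProjection x :=
    Submodule.starProjection_eq_self_iff.2 (Submodule.starProjection_apply_mem _ _)
  set w := Kᗮ.starProjection x with hwdef
  have hw0 : w ≠ 0 := fun h => hw (h ▸ T.zero_mem)
  have hφ : ‖w‖ ^ 2 ≠ 0 := by positivity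
  have hproj : T.starProjection w ∈ T := Submodule.starProjection_apply_mem _ _
  have hν0 : w - T.starProjection w ≠ 0 := fun h => hw (sub_eq_zero.1 h ▸ hproj)
  have hνT : ∀ t ∈ T, (inner ℝ (w - T.starProjection w) t : ℝ) = 0 :=
    fun t ht => Submodule.starProjection_inner_eq_zero _ _ ht
  -- The spherical component z of the projection of `w` to `T` is zero: it lies in `T` by `hT`, and
  -- pairing `hT z` with the normal ν = w − π_T w yields ⟨z, z⟩ = 0.
  have hPproj : Kᗮ.starProjection (T.starProjection w) =
      ((‖w‖ ^ 2)⁻¹ * inner ℝ w (T.starProjection w) : ℝ) • w := by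
    rw [← sub_eq_zero, ← inner_self_eq_zero (𝕜 := ℝ)]
    have hz := hT _ hproj
    set z := Kᗮ.starProjection (T.starProjection w) -
      ((‖w‖ ^ 2)⁻¹ * inner ℝ w (T.starProjection w) : ℝ) • w with hzdef
    have h1 := hνT _ (hT z hz)
    have h2 : (inner ℝ w (Kᗮ.starProjection z - ((‖w‖ ^ 2)⁻¹ * inner ℝ w z : ℝ) • w) : ℝ) = 0 := by
      rw [inner_sub_right, hself, inner_smul_right, real_inner_self_eq_norm_sq]
      field_simp
      ring
    rw [inner_sub_left, h2, zero_sub, neg_eq_zero, inner_sub_right, inner_smul_right,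
      ← Submodule.inner_starProjection_left_eq_right] at h1
    conv_lhs => arg 2; rw [hzdef]
    rw [inner_sub_left, inner_smul_left, real_inner_comm (T.starProjection w) w]
    simp only [conj_trivial]
    linear_combination h1
  have hνν : ‖w - T.starProjection w‖ ^ 2 = ‖w‖ ^ 2 - inner ℝ w (T.starProjection w) := by
    have := hνT _ hproj
    rw [inner_sub_left] at this
    rw [norm_sub_sq_real, ← real_inner_self_eq_norm_sq (T.starProjection w)]
    linear_combination -this
  have hν2 : ‖w - T.starProjection w‖ ^ 2 ≠ 0 := by positivity
  -- By `hPproj`, Pν = (‖ν‖²/‖w‖²)w, so this is the only multiple of ν whose subtraction moves `x`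
  -- into `K`.
  refine ⟨x - (‖w‖ ^ 2 / ‖w - T.starProjection w‖ ^ 2) • (w - T.starProjection w), ?_, ?_, ?_, ?_⟩
  · rw [← starProjection_orthogonal_eq_zero_iff, map_sub, map_smul, map_sub, hPw, hPproj, ← hwdef]
    have : ‖w‖ ^ 2 / ‖w - T.starProjection w‖ ^ 2 *
        (1 - (‖w‖ ^ 2)⁻¹ * inner ℝ w (T.starProjection w)) = 1 := by
      rw [hνν] at hν2 ⊢
      field_simp
    calc _ = (1 - ‖w‖ ^ 2 / ‖w - T.starProjection w‖ ^ 2 *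
        (1 - (‖w‖ ^ 2)⁻¹ * inner ℝ w (T.starProjection w))) • w := by module
      _ = 0 := by rw [this, sub_self, zero_smul]
  · intro h
    have h1 := sub_eq_self.1 h.symm
    rcases smul_eq_zero.1 h1 with h1 | h1
    · exact (div_ne_zero hφ hν2) h1
    · exact hν0 h1
  · rw [sub_sub_cancel]
    exact Submodule.smul_mem _ _ (Submodule.sub_mem _
      (Submodule.mem_sup_right (Submodule.mem_span_singleton_self w)) (Submodule.mem_sup_left hproj))
  · intro t ht
    rw [sub_sub_cancel, inner_smul_left, hνT t ht, mul_zero]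

/-! ### Propagation of first order contact. -/

omit [FiniteDimensional ℝ D] in
theorem fderiv_mem_of_eventually_sub_mem {G : D → E} {y : D} {W : Submodule ℝ E} {c : E}
    (hG : DifferentiableAt ℝ G y) (h : ∀ᶠ z in 𝓝 y, G z - c ∈ W) (u : D) :
    fderiv ℝ G y u ∈ W := by
  rw [← starProjection_orthogonal_eq_zero_iff]
  have h1 : HasFDerivAt (fun z => Wᗮ.starProjection (G z - c)) (Wᗮ.starProjection ∘L fderiv ℝ G y) y :=
    Wᗮ.starProjection.hasFDerivAt.comp y (hG.hasFDerivAt.sub_const c)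
  have h2 : HasFDerivAt (fun z => Wᗮ.starProjection (G z - c)) (0 : D →L[ℝ] E) y :=
    (hasFDerivAt_const (0 : E) y).congr_of_eventuallyEq
      (h.mono fun z hz => starProjection_orthogonal_eq_zero_iff.2 hz)
  exact congrArg (fun T : D →L[ℝ] E => T u) (h1.unique h2)

/-- Let R project onto the orthogonal complement of `W`. It commutes with P, and Pc = 0, so Rq(F) =
‖PF‖⁻² P R(F − c). Hence the pair (R(F − c), R DF) has derivative bounded by a multiple of itself,
and it vanishes at `y`. -/
theorem eventually_sub_mem {K W : Submodule ℝ E} {F : D → E} {y : D} {c : E}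
    (hF : ContDiffAt ℝ ∞ F y) (hinj : Function.Injective (fderiv ℝ F y))
    (hy : Kᗮ.starProjection (F y) ≠ 0) (hg : ∀ᶠ z in 𝓝 y, IsGeodesicAt K F z)
    (hc : c ∈ K) (hW : ∀ w ∈ W, Kᗮ.starProjection w ∈ W) (hyc : F y - c ∈ W)
    (hT : ∀ u, fderiv ℝ F y u ∈ W) : ∀ᶠ z in 𝓝 y, F z - c ∈ W := by
  obtain ⟨Γ, -, ⟨C, hC0, hC⟩, hE⟩ := exists_tangential_coefficients hF hinj hy hg
  have hF1 : ContDiffAt ℝ ∞ (fderiv ℝ F) y := hF.fderiv_right (by simp)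
  have hd0 : ∀ᶠ z in 𝓝 y, DifferentiableAt ℝ F z :=
    ((hF.of_le (by simp : (1 : WithTop ℕ∞) ≤ ∞)).eventually (by simp)).mono
      fun z hz => hz.differentiableAt (by simp)
  have hd1 : ∀ᶠ z in 𝓝 y, DifferentiableAt ℝ (fderiv ℝ F) z :=
    ((hF1.of_le (by simp : (1 : WithTop ℕ∞) ≤ ∞)).eventually (by simp)).mono
      fun z hz => hz.differentiableAt (by simp)
  let R := Wᗮ.starProjection
  let R' : (D →L[ℝ] E) →L[ℝ] (D →L[ℝ] E) := ContinuousLinearMap.compL ℝ D E E R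
  let Z : D → E × (D →L[ℝ] E) := fun z => (R (F z - c), R' (fderiv ℝ F z))
  have hZ : ∀ᶠ z in 𝓝 y, HasFDerivAt Z
      ((R ∘L fderiv ℝ F z).prod (R' ∘L fderiv ℝ (fderiv ℝ F) z)) z := by
    filter_upwards [hd0, hd1] with z h0 h1
    exact (R.hasFDerivAt.comp z (h0.hasFDerivAt.sub_const c)).prodMk
      (R'.hasFDerivAt.comp z h1.hasFDerivAt)
  have hB : ContinuousAt (fun z => ‖fderiv ℝ F z‖ * ‖fderiv ℝ F z‖ *
      (‖Kᗮ.starProjection (F z)‖ ^ 2)⁻¹) y := by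
    have h1 := hF1.continuousAt.norm
    have h2 : ContinuousAt (fun z => ‖Kᗮ.starProjection (F z)‖ ^ 2) y :=
      ((Kᗮ.starProjection.continuous.continuousAt.comp hF.continuousAt).norm).pow 2
    exact (h1.mul h1).mul (h2.inv₀ (by positivity))
  have hz := eventually_eq_zero_of_norm_fderiv_le (Z := Z) (y := y)
    -- The 1 serves the first component of `Z`; the rest serves the second, with `C` bounding Γ and
    -- the other term bounding ‖DF‖²‖PF‖⁻² near `y`.
    (C := 1 + (C + (‖fderiv ℝ F y‖ * ‖fderiv ℝ F y‖ * (‖Kᗮ.starProjection (F y)‖ ^ 2)⁻¹ + 1)))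
    (hZ.mono fun z hz => hz.differentiableAt) ?_ ?_
  · exact hz.mono fun z hz => starProjection_orthogonal_eq_zero_iff.1 (congrArg Prod.fst hz)
  · filter_upwards [hZ, hC, hE, hB.eventually (gt_mem_nhds (lt_add_one _))] with z h1 h2 h3 h4 v
    rw [h1.fderiv]
    set B := ‖fderiv ℝ F y‖ * ‖fderiv ℝ F y‖ * (‖Kᗮ.starProjection (F y)‖ ^ 2)⁻¹ + 1
    have hB0 : 0 ≤ B := by positivity
    have hZ1 : ‖R (F z - c)‖ ≤ ‖Z z‖ := norm_fst_le (Z z)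
    have hZ2 : ‖R' (fderiv ℝ F z)‖ ≤ ‖Z z‖ := norm_snd_le (Z z)
    refine max_le ?_ ?_
    · calc ‖R (fderiv ℝ F z v)‖ ≤ ‖R' (fderiv ℝ F z)‖ * ‖v‖ :=
            (R' (fderiv ℝ F z)).le_opNorm v
        _ ≤ (1 + (C + B)) * ‖Z z‖ * ‖v‖ := by
            gcongr
            nlinarith [norm_nonneg (Z z)]
    · refine ContinuousLinearMap.opNorm_le_bound _ (by positivity) fun u => ?_
      have hRq : ‖R (axialField K (F z))‖ ≤ (‖Kᗮ.starProjection (F z)‖ ^ 2)⁻¹ * ‖Z z‖ := by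
        have h5 : R (axialField K (F z)) =
            (‖Kᗮ.starProjection (F z)‖ ^ 2)⁻¹ • Kᗮ.starProjection (R (F z - c)) := by
          rw [← starProjection_comm_of_invariant hW, map_sub,
            starProjection_orthogonal_eq_zero_iff.2 hc, sub_zero, axialField, map_smul]
        rw [h5, norm_smul, Real.norm_of_nonneg (by positivity)]
        gcongr
        exact (Submodule.norm_starProjection_apply_le _ _).trans hZ1
      change ‖R (fderiv ℝ (fderiv ℝ F) z v u)‖ ≤ _
      rw [h3, map_sub, map_smul]
      calc _ ≤ ‖R' (fderiv ℝ F z) (Γ v u z)‖ +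
            ‖(inner ℝ (fderiv ℝ F z v) (fderiv ℝ F z u) : ℝ)‖ * ‖R (axialField K (F z))‖ := by
            rw [← norm_smul]
            exact norm_sub_le _ _
        _ ≤ ‖Z z‖ * (C * ‖v‖ * ‖u‖) + ((‖fderiv ℝ F z‖ * ‖v‖) * (‖fderiv ℝ F z‖ * ‖u‖)) *
            ((‖Kᗮ.starProjection (F z)‖ ^ 2)⁻¹ * ‖Z z‖) := by
            gcongr
            · exact ((R' (fderiv ℝ F z)).le_opNorm _).trans
                (mul_le_mul hZ2 (h2 v u) (norm_nonneg _) (norm_nonneg _))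
            · exact (norm_inner_le_norm _ _).trans (mul_le_mul (ContinuousLinearMap.le_opNorm _ _)
                (ContinuousLinearMap.le_opNorm _ _) (norm_nonneg _) (by positivity))
        _ = (C + ‖fderiv ℝ F z‖ * ‖fderiv ℝ F z‖ * (‖Kᗮ.starProjection (F z)‖ ^ 2)⁻¹) *
            (‖Z z‖ * ‖v‖ * ‖u‖) := by ring
        _ ≤ (1 + (C + B)) * (‖Z z‖ * ‖v‖ * ‖u‖) := by
            refine mul_le_mul_of_nonneg_right ?_ (by positivity)
            linarith
        _ = _ := by ring
  · refine Prod.ext (starProjection_orthogonal_eq_zero_iff.2 hyc) ?_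
    ext1 u
    exact starProjection_orthogonal_eq_zero_iff.2 (hT u)

theorem inner_axialField_sub_center {K : Submodule ℝ E} {x c : E} (hc : c ∈ K)
    (hx : Kᗮ.starProjection x ≠ 0) : (inner ℝ (x - c) (axialField K x) : ℝ) = 1 := by
  have h1 : (inner ℝ c (Kᗮ.starProjection x) : ℝ) = 0 :=
    Submodule.inner_right_of_mem_orthogonal hc (Submodule.starProjection_apply_mem _ _)
  have h2 : ‖Kᗮ.starProjection x‖ ^ 2 ≠ 0 := by positivity
  rw [axialField, inner_smul_right, inner_sub_left, h1, sub_zero, real_inner_comm,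
    ← inner_starProjection_self, real_inner_self_eq_norm_sq, inv_mul_cancel₀ h2]

/-- For Z = ⟨F − c, DF ·⟩, the term ⟨DF v, DF u⟩ in the derivative cancels against the q-term
because ⟨F − c, q⟩ = 1. What remains is Z(Γ(v,u)), so Z vanishes near `y` and ‖F − c‖² is constant
there. -/
theorem eventually_norm_sub_eq {K : Submodule ℝ E} {F : D → E} {y : D} {c : E}
    (hF : ContDiffAt ℝ ∞ F y) (hinj : Function.Injective (fderiv ℝ F y))
    (hy : Kᗮ.starProjection (F y) ≠ 0) (hg : ∀ᶠ z in 𝓝 y, IsGeodesicAt K F z)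
    (hc : c ∈ K) (hT : ∀ u, (inner ℝ (F y - c) (fderiv ℝ F y u) : ℝ) = 0) :
    ∀ᶠ z in 𝓝 y, ‖F z - c‖ = ‖F y - c‖ := by
  obtain ⟨Γ, -, ⟨C, hC0, hC⟩, hE⟩ := exists_tangential_coefficients hF hinj hy hg
  have hF1 : ContDiffAt ℝ ∞ (fderiv ℝ F) y := hF.fderiv_right (by simp)
  have hd0 : ∀ᶠ z in 𝓝 y, DifferentiableAt ℝ F z :=
    ((hF.of_le (by simp : (1 : WithTop ℕ∞) ≤ ∞)).eventually (by simp)).mono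
      fun z hz => hz.differentiableAt (by simp)
  have hd1 : ∀ᶠ z in 𝓝 y, DifferentiableAt ℝ (fderiv ℝ F) z :=
    ((hF1.of_le (by simp : (1 : WithTop ℕ∞) ≤ ∞)).eventually (by simp)).mono
      fun z hz => hz.differentiableAt (by simp)
  have hne : ∀ᶠ z in 𝓝 y, Kᗮ.starProjection (F z) ≠ 0 :=
    (Kᗮ.starProjection.continuous.continuousAt.comp hF.continuousAt).eventually_ne hy
  let Z : D → D →L[ℝ] ℝ := fun z => (innerSL ℝ (F z - c)) ∘L fderiv ℝ F z
  have hZ : ∀ᶠ z in 𝓝 y, DifferentiableAt ℝ Z z ∧ ∀ v u, fderiv ℝ Z z v u =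
      inner ℝ (fderiv ℝ F z v) (fderiv ℝ F z u) +
        inner ℝ (F z - c) (fderiv ℝ (fderiv ℝ F) z v u) := by
    filter_upwards [hd0, hd1] with z h0 h1
    have h2 : HasFDerivAt (fun z => innerSL ℝ (F z - c)) ((innerSL ℝ) ∘L fderiv ℝ F z) z :=
      (innerSL ℝ).hasFDerivAt.comp z (h0.hasFDerivAt.sub_const c)
    have h3 := h2.clm_comp h1.hasFDerivAt
    refine ⟨h3.differentiableAt, fun v u => ?_⟩
    have h4 : fderiv ℝ Z z = _ := h3.fderiv
    rw [h4]
    exact add_comm _ _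
  have hz := eventually_eq_zero_of_norm_fderiv_le (Z := Z) (y := y) (C := C)
    (hZ.mono fun z hz => hz.1) ?_ ?_
  · have hn := eventually_eq_zero_of_norm_fderiv_le
      (Z := fun z => ‖F z - c‖ ^ 2 - ‖F y - c‖ ^ 2) (y := y) (C := 0) ?_ ?_ (sub_self _)
    · filter_upwards [hn] with z hz
      exact (sq_eq_sq₀ (norm_nonneg _) (norm_nonneg _)).1 (sub_eq_zero.1 hz)
    · filter_upwards [hd0] with z h0
      exact ((h0.sub_const c).norm_sq ℝ).sub_const _
    · filter_upwards [hd0, hz] with z h0 h1 v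
      have h2 := ((h0.hasFDerivAt.sub_const c).norm_sq).sub_const (‖F y - c‖ ^ 2)
      have h3 : (inner ℝ (F z - c) (fderiv ℝ F z v) : ℝ) = 0 :=
        congrArg (fun T : D →L[ℝ] ℝ => T v) h1
      rw [h2.fderiv]
      simp [h3, -map_sub]
  · filter_upwards [hZ, hC, hE, hne] with z h1 h2 h3 h4 v
    refine ContinuousLinearMap.opNorm_le_bound _ (by positivity) fun u => ?_
    have h5 : fderiv ℝ Z z v u = Z z (Γ v u z) := by
      rw [h1.2, h3, inner_sub_right, inner_smul_right, inner_axialField_sub_center hc h4, mul_one]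
      exact add_sub_cancel _ _
    rw [h5]
    calc _ ≤ ‖Z z‖ * (C * ‖v‖ * ‖u‖) :=
          ((Z z).le_opNorm _).trans (mul_le_mul_of_nonneg_left (h2 v u) (norm_nonneg _))
      _ = _ := by ring
  · ext1 u
    exact hT u

/-! ### Affine and spherical models satisfy the equation. -/

theorem finrank_sup_span_singleton {T : Submodule ℝ E} {e : E} (he : e ∉ T) :
    Module.finrank ℝ ↥(T ⊔ Submodule.span ℝ {e}) = Module.finrank ℝ T + 1 := by
  have he0 : e ≠ 0 := fun h => he (h ▸ T.zero_mem)
  have h1 : T ⊓ Submodule.span ℝ {e} = ⊥ :=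
    disjoint_iff.1 ((Submodule.disjoint_span_singleton' he0).2 he)
  have h2 := Submodule.finrank_sup_add_finrank_inf_eq T (Submodule.span ℝ {e})
  rw [h1, finrank_bot, finrank_span_singleton he0] at h2
  exact h2

theorem eq_sup_span_singleton {T W : Submodule ℝ E} {e : E} (hTW : T ≤ W) (heW : e ∈ W)
    (heT : e ∉ T) (hfin : Module.finrank ℝ W = Module.finrank ℝ T + 1) :
    W = T ⊔ Submodule.span ℝ {e} :=
  (Submodule.eq_of_le_of_finrank_eq (sup_le hTW ((Submodule.span_singleton_le_iff_mem e W).2 heW))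
    ((finrank_sup_span_singleton heT).trans hfin.symm)).symm

omit [FiniteDimensional ℝ E] in
theorem notMem_of_inner_eq_zero {T : Submodule ℝ E} {e : E} (he : e ≠ 0)
    (hT : ∀ t ∈ T, (inner ℝ e t : ℝ) = 0) : e ∉ T :=
  fun h => he (inner_self_eq_zero.1 (hT e h))

theorem mem_of_inner_eq_zero {T W : Submodule ℝ E} {e d : E} (hTW : T ≤ W) (heW : e ∈ W)
    (he : e ≠ 0) (hT : ∀ t ∈ T, (inner ℝ e t : ℝ) = 0)
    (hfin : Module.finrank ℝ W = Module.finrank ℝ T + 1) (hd : d ∈ W)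
    (hde : (inner ℝ e d : ℝ) = 0) : d ∈ T := by
  rw [eq_sup_span_singleton hTW heW (notMem_of_inner_eq_zero he hT) hfin,
    Submodule.mem_sup] at hd
  obtain ⟨t, ht, s, hs, rfl⟩ := hd
  obtain ⟨a, rfl⟩ := Submodule.mem_span_singleton.1 hs
  rw [inner_add_right, hT t ht, inner_smul_right, zero_add] at hde
  rcases mul_eq_zero.1 hde with h | h
  · simpa [h] using ht
  · exact absurd (inner_self_eq_zero.1 h) he

theorem exists_smul_eq_of_mem_orthogonal {T W : Submodule ℝ E} {e d : E} (hTW : T ≤ W)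
    (heW : e ∈ W) (he : e ≠ 0) (hT : ∀ t ∈ T, (inner ℝ e t : ℝ) = 0)
    (hfin : Module.finrank ℝ W = Module.finrank ℝ T + 1) (hd : d ∈ W) (hdT : d ∈ Tᗮ) :
    ∃ a : ℝ, d = a • e := by
  rw [eq_sup_span_singleton hTW heW (notMem_of_inner_eq_zero he hT) hfin,
    Submodule.mem_sup] at hd
  obtain ⟨t, ht, s, hs, rfl⟩ := hd
  obtain ⟨a, rfl⟩ := Submodule.mem_span_singleton.1 hs
  refine ⟨a, ?_⟩
  have h1 : (inner ℝ t (t + a • e) : ℝ) = 0 := Submodule.inner_right_of_mem_orthogonal ht hdT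
  rw [inner_add_right, inner_smul_right, real_inner_comm, real_inner_comm e t, hT t ht, mul_zero,
    add_zero] at h1
  rw [inner_self_eq_zero.1 h1, zero_add]

omit [FiniteDimensional ℝ D] in
theorem range_fderiv_eq {F : D → E} {y : D} {W : Submodule ℝ E}
    (hinj : Function.Injective (fderiv ℝ F y)) (hW : ∀ u, fderiv ℝ F y u ∈ W)
    (hfin : Module.finrank ℝ W = Module.finrank ℝ D) :
    LinearMap.range (fderiv ℝ F y : D →ₗ[ℝ] E) = W := by
  refine Submodule.eq_of_le_of_finrank_eq ?_ ?_
  · rintro _ ⟨u, rfl⟩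
    exact hW u
  · rw [LinearMap.finrank_range_of_inj hinj, hfin]

theorem axialField_mem {K W : Submodule ℝ E} {x c : E} (hc : c ∈ K)
    (hW : ∀ w ∈ W, Kᗮ.starProjection w ∈ W) (hx : x - c ∈ W) : axialField K x ∈ W := by
  refine Submodule.smul_mem _ _ ?_
  have := hW _ hx
  rwa [map_sub, starProjection_orthogonal_eq_zero_iff.2 hc, sub_zero] at this

omit [FiniteDimensional ℝ D] in
theorem fderiv_fderiv_mem {F : D → E} {y : D} {W : Submodule ℝ E} {c : E}
    (hF : ContDiffAt ℝ ∞ F y) (h : ∀ᶠ z in 𝓝 y, F z - c ∈ W) (u v : D) :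
    fderiv ℝ (fderiv ℝ F) y u v ∈ W := by
  have hF1 : ContDiffAt ℝ ∞ (fderiv ℝ F) y := hF.fderiv_right (by simp)
  have hd0 : ∀ᶠ z in 𝓝 y, DifferentiableAt ℝ F z :=
    ((hF.of_le (by simp : (1 : WithTop ℕ∞) ≤ ∞)).eventually (by simp)).mono
      fun z hz => hz.differentiableAt (by simp)
  have h1 := (hF1.differentiableAt (by simp)).hasFDerivAt.clm_apply (hasFDerivAt_const v y)
  have h2 := fderiv_mem_of_eventually_sub_mem (c := 0) (W := W) h1.differentiableAt
    (by
      filter_upwards [hd0, h.eventually_nhds] with z hz hz'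
      rw [sub_zero]
      exact fderiv_mem_of_eventually_sub_mem hz hz' v) u
  rw [h1.fderiv] at h2
  simpa using h2

/-- Here T = `W` by dimension, and both D²F(u,v) and q lie in `W`. -/
theorem isGeodesicAt_of_eventually_mem_affine {K W : Submodule ℝ E} {F : D → E} {y : D} {c : E}
    (hF : ContDiffAt ℝ ∞ F y) (hinj : Function.Injective (fderiv ℝ F y)) (hc : c ∈ K)
    (hW : ∀ w ∈ W, Kᗮ.starProjection w ∈ W) (hfin : Module.finrank ℝ W = Module.finrank ℝ D)
    (h : ∀ᶠ z in 𝓝 y, F z - c ∈ W) : IsGeodesicAt K F y := by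
  intro u v
  have hT := fderiv_mem_of_eventually_sub_mem (hF.differentiableAt (by simp)) h
  rw [range_fderiv_eq hinj hT hfin]
  exact W.add_mem (fderiv_fderiv_mem hF h u v)
    (W.smul_mem _ (axialField_mem hc hW h.self_of_nhds))

omit [FiniteDimensional ℝ D] [FiniteDimensional ℝ E] in
theorem inner_sub_fderiv_eq_zero {F : D → E} {y : D} {c : E} {r : ℝ}
    (hF : DifferentiableAt ℝ F y) (h : ∀ᶠ z in 𝓝 y, ‖F z - c‖ = r) (u : D) :
    (inner ℝ (F y - c) (fderiv ℝ F y u) : ℝ) = 0 := by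
  have h1 := (hF.hasFDerivAt.sub_const c).norm_sq
  have h2 : HasFDerivAt (fun z => ‖F z - c‖ ^ 2) (0 : D →L[ℝ] ℝ) y :=
    (hasFDerivAt_const (r ^ 2) y).congr_of_eventuallyEq (h.mono fun z hz => by simp [hz])
  have h3 := congrArg (fun T : D →L[ℝ] ℝ => T u) (h1.unique h2)
  simpa [-map_sub] using h3

/-- Now T is the hyperplane of `W` normal to F − c. Differentiating ⟨F − c, DF v⟩ = 0 gives ⟨F − c,
D²F(u,v)⟩ = −⟨DF u, DF v⟩, which ⟨F − c, q⟩ = 1 compensates. -/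
theorem isGeodesicAt_of_eventually_mem_sphere {K W : Submodule ℝ E} {F : D → E} {y : D} {c : E}
    {r : ℝ} (hF : ContDiffAt ℝ ∞ F y) (hinj : Function.Injective (fderiv ℝ F y)) (hc : c ∈ K)
    (hy : Kᗮ.starProjection (F y) ≠ 0)
    (hW : ∀ w ∈ W, Kᗮ.starProjection w ∈ W) (hfin : Module.finrank ℝ W = Module.finrank ℝ D + 1)
    (h : ∀ᶠ z in 𝓝 y, F z - c ∈ W) (hr : ∀ᶠ z in 𝓝 y, ‖F z - c‖ = r) :
    IsGeodesicAt K F y := by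
  intro u v
  have hF1 : ContDiffAt ℝ ∞ (fderiv ℝ F) y := hF.fderiv_right (by simp)
  have hd0 : ∀ᶠ z in 𝓝 y, DifferentiableAt ℝ F z :=
    ((hF.of_le (by simp : (1 : WithTop ℕ∞) ≤ ∞)).eventually (by simp)).mono
      fun z hz => hz.differentiableAt (by simp)
  have hT := fderiv_mem_of_eventually_sub_mem (hF.differentiableAt (by simp)) h
  have he : F y - c ≠ 0 := by
    intro he
    rw [sub_eq_zero.1 he] at hy
    exact hy (starProjection_orthogonal_eq_zero_iff.2 hc)
  refine mem_of_inner_eq_zero (W := W) (e := F y - c) ?_ h.self_of_nhds he ?_ ?_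
    (W.add_mem (fderiv_fderiv_mem hF h u v)
      (W.smul_mem _ (axialField_mem hc hW h.self_of_nhds))) ?_
  · rintro _ ⟨u, rfl⟩
    exact hT u
  · rintro _ ⟨u, rfl⟩
    exact inner_sub_fderiv_eq_zero (hF.differentiableAt (by simp)) hr u
  · rw [LinearMap.finrank_range_of_inj hinj, hfin]
  · have h1 := ((hF.differentiableAt (by simp)).hasFDerivAt.sub_const c).inner ℝ
      ((hF1.differentiableAt (by simp)).hasFDerivAt.clm_apply (hasFDerivAt_const v y))
    have h2 : HasFDerivAt (fun z => (inner ℝ (F z - c) (fderiv ℝ F z v) : ℝ)) (0 : D →L[ℝ] ℝ) y := by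
      refine (hasFDerivAt_const (0 : ℝ) y).congr_of_eventuallyEq ?_
      filter_upwards [hd0, hr.eventually_nhds] with z hz hz'
      exact inner_sub_fderiv_eq_zero hz hz' v
    have h3 := congrArg (fun T : D →L[ℝ] ℝ => T u) (h1.unique h2)
    rw [inner_add_right, inner_smul_right, inner_axialField_sub_center hc hy, mul_one]
    simpa [-map_sub, inner_sub_left] using h3

/-! ### Openness of the image in the model, and change of parameters. -/

omit [FiniteDimensional ℝ E] in
-- The orthogonal projection of F to its tangent space is a submersion at `y`, hence locally open.
-- As `hSV` makes this projection injective on `S ∩ V`, a point of `S` near F(y) equals the F(z)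
-- with the same projection.
theorem exists_nhds_inter_subset_image {F : D → E} {y : D} {S V : Set E} (hF : ContDiffAt ℝ ∞ F y)
    (hS : ∀ᶠ z in 𝓝 y, F z ∈ S) (hV : V ∈ 𝓝 (F y))
    (hSV : ∀ x ∈ S ∩ V, ∀ x' ∈ S ∩ V,
      x - x' ∈ (LinearMap.range (fderiv ℝ F y : D →ₗ[ℝ] E))ᗮ → x = x')
    {N : Set D} (hN : N ∈ 𝓝 y) : ∃ U ∈ 𝓝 (F y), S ∩ U ⊆ F '' N := by
  set T := LinearMap.range (fderiv ℝ F y : D →ₗ[ℝ] E) with hT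
  let π : E →L[ℝ] T := T.orthogonalProjectionOnto
  have h1 : HasStrictFDerivAt (fun z => π (F z)) (π ∘L fderiv ℝ F y) y :=
    π.hasStrictFDerivAt.comp y (hF.hasStrictFDerivAt (by simp))
  have h2 : (π ∘L fderiv ℝ F y).range = ⊤ := by
    rw [LinearMap.range_eq_top]
    rintro ⟨_, u, rfl⟩
    exact ⟨u, T.orthogonalProjectionOnto_mem_subspace_eq_self ⟨_, u, rfl⟩⟩
  have h3 := h1.map_nhds_eq_of_surj h2
  have h4 : N ∩ {z | F z ∈ S} ∩ F ⁻¹' V ∈ 𝓝 y :=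
    inter_mem (inter_mem hN hS) (hF.continuousAt.preimage_mem_nhds hV)
  have h5 := image_mem_map (m := fun z => π (F z)) h4
  rw [h3] at h5
  refine ⟨V ∩ π ⁻¹' _, inter_mem hV (π.continuous.continuousAt.preimage_mem_nhds h5), ?_⟩
  rintro x ⟨hxS, hxV, z, ⟨⟨hzN, hzS⟩, hzV⟩, hz⟩
  refine ⟨z, hzN, hSV _ ⟨hzS, hzV⟩ _ ⟨hxS, hxV⟩ ?_⟩
  rw [← T.ker_orthogonalProjectionOnto, LinearMap.mem_ker, map_sub, sub_eq_zero]
  exact hz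

theorem exists_nhds_inter_subset_image_affine {W : Submodule ℝ E} {F : D → E} {y : D} {c : E}
    (hF : ContDiffAt ℝ ∞ F y) (hinj : Function.Injective (fderiv ℝ F y))
    (hfin : Module.finrank ℝ W = Module.finrank ℝ D) (h : ∀ᶠ z in 𝓝 y, F z - c ∈ W)
    {N : Set D} (hN : N ∈ 𝓝 y) : ∃ U ∈ 𝓝 (F y), {x | x - c ∈ W} ∩ U ⊆ F '' N := by
  refine exists_nhds_inter_subset_image hF h univ_mem ?_ hN
  rw [range_fderiv_eq hinj
    (fderiv_mem_of_eventually_sub_mem (hF.differentiableAt (by simp)) h) hfin]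
  rintro x ⟨hx, -⟩ x' ⟨hx', -⟩ hxx
  have h1 : x - x' ∈ W := by
    have := W.sub_mem hx hx'
    rwa [sub_sub_sub_cancel_right] at this
  exact sub_eq_zero.1 (inner_self_eq_zero.1 (Submodule.inner_right_of_mem_orthogonal h1 hxx))

theorem exists_nhds_inter_subset_image_sphere {W : Submodule ℝ E} {F : D → E} {y : D} {c : E}
    {r : ℝ} (hF : ContDiffAt ℝ ∞ F y) (hinj : Function.Injective (fderiv ℝ F y)) (hr0 : 0 < r)
    (hfin : Module.finrank ℝ W = Module.finrank ℝ D + 1) (h : ∀ᶠ z in 𝓝 y, F z - c ∈ W)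
    (hr : ∀ᶠ z in 𝓝 y, ‖F z - c‖ = r) {N : Set D} (hN : N ∈ 𝓝 y) :
    ∃ U ∈ 𝓝 (F y), {x | x - c ∈ W ∧ ‖x - c‖ = r} ∩ U ⊆ F '' N := by
  have he : F y - c ≠ 0 := by
    rw [← norm_ne_zero_iff, hr.self_of_nhds]
    exact hr0.ne'
  -- The half-space excludes the opposite cap, where the sphere has a second point with the same
  -- tangential projection.
  have hV : {x | 0 < (inner ℝ (F y - c) (x - c) : ℝ)} ∈ 𝓝 (F y) := by
    refine (isOpen_lt continuous_const (by fun_prop)).mem_nhds ?_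
    exact real_inner_self_pos.2 he
  refine exists_nhds_inter_subset_image hF (h.and hr) hV ?_ hN
  rintro x ⟨⟨hx, hxr⟩, hxV⟩ x' ⟨⟨hx', hxr'⟩, hxV'⟩ hxx
  have h1 : x - x' ∈ W := by
    have := W.sub_mem hx hx'
    rwa [sub_sub_sub_cancel_right] at this
  obtain ⟨a, ha⟩ : ∃ a : ℝ, x - x' = a • (F y - c) := by
    refine exists_smul_eq_of_mem_orthogonal ?_ h.self_of_nhds he ?_ ?_ h1 hxx
    · rintro _ ⟨u, rfl⟩
      exact fderiv_mem_of_eventually_sub_mem (hF.differentiableAt (by simp)) h u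
    · rintro _ ⟨u, rfl⟩
      exact inner_sub_fderiv_eq_zero (hF.differentiableAt (by simp)) hr u
    · rw [LinearMap.finrank_range_of_inj hinj, hfin]
  have h2 : (inner ℝ (x - x') ((x - c) + (x' - c)) : ℝ) = 0 := by
    rw [← sub_sub_sub_cancel_right x x' c, real_inner_comm, real_inner_add_sub_eq_zero_iff,
      hxr, hxr']
  rw [ha, inner_smul_left, inner_add_right] at h2
  rcases mul_eq_zero.1 h2 with h3 | h3
  · have h4 : a = 0 := h3
    rw [h4, zero_smul] at ha
    exact sub_eq_zero.1 ha
  · exact absurd h3 (add_pos hxV hxV').ne'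

/-- The extra second order term of the chain rule, DF(D²τ), is tangential. -/
theorem isGeodesicAt_of_comp {K : Submodule ℝ E} {F G : D → E} {τ : D → D} {y : D}
    (hF : ContDiffAt ℝ ∞ F (τ y)) (hτ : ContDiffAt ℝ ∞ τ y) (hG : G =ᶠ[𝓝 y] F ∘ τ)
    (hinj : Function.Injective (fderiv ℝ G y)) (h : IsGeodesicAt K F (τ y)) :
    IsGeodesicAt K G y := by
  have hF1 : ContDiffAt ℝ ∞ (fderiv ℝ F) (τ y) := hF.fderiv_right (by simp)
  have hτ1 : ContDiffAt ℝ ∞ (fderiv ℝ τ) y := hτ.fderiv_right (by simp)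
  have hFd : ∀ᶠ z in 𝓝 (τ y), DifferentiableAt ℝ F z :=
    ((hF.of_le (by simp : (1 : WithTop ℕ∞) ≤ ∞)).eventually (by simp)).mono
      fun z hz => hz.differentiableAt (by simp)
  have hτd : ∀ᶠ z in 𝓝 y, DifferentiableAt ℝ τ z :=
    ((hτ.of_le (by simp : (1 : WithTop ℕ∞) ≤ ∞)).eventually (by simp)).mono
      fun z hz => hz.differentiableAt (by simp)
  have h1 : fderiv ℝ G =ᶠ[𝓝 y] fun z => fderiv ℝ F (τ z) ∘L fderiv ℝ τ z := by
    filter_upwards [hG.eventually_nhds, hτ.continuousAt.eventually hFd, hτd] with z hz hz1 hz2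
    rw [Filter.EventuallyEq.fderiv_eq hz, fderiv_comp z hz1 hz2]
  have h2 : ∀ u v, fderiv ℝ (fderiv ℝ G) y u v =
      fderiv ℝ (fderiv ℝ F) (τ y) (fderiv ℝ τ y u) (fderiv ℝ τ y v) +
        fderiv ℝ F (τ y) (fderiv ℝ (fderiv ℝ τ) y u v) := by
    intro u v
    have h3 : HasFDerivAt (fun z => fderiv ℝ F (τ z)) _ y :=
      (hF1.differentiableAt (by simp)).hasFDerivAt.comp y (hτ.differentiableAt (by simp)).hasFDerivAt
    have h4 := h3.clm_comp (hτ1.differentiableAt (by simp)).hasFDerivAt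
    rw [h1.fderiv_eq, h4.fderiv]
    exact add_comm _ _
  have h5 := h1.self_of_nhds
  have h6 : LinearMap.range (fderiv ℝ F (τ y) : D →ₗ[ℝ] E) =
      LinearMap.range (fderiv ℝ G y : D →ₗ[ℝ] E) := by
    symm
    refine Submodule.eq_of_le_of_finrank_le ?_ ?_
    · rintro _ ⟨u, rfl⟩
      rw [h5]
      exact ⟨_, rfl⟩
    · rw [LinearMap.finrank_range_of_inj hinj]
      exact LinearMap.finrank_range_le _
  intro u v
  rw [← h6, h2, h5, hG.self_of_nhds, add_right_comm]
  exact Submodule.add_mem _ (h _ _) ⟨_, rfl⟩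

end LocalGeometry

/-! ### The model metric and the model subsets. -/

section Model

open Filter Topology

variable {n k m : ℕ}

theorem starProjection_ne_zero_of_notMem {x : EuclideanSpace ℝ (Fin (n + 1))} (hx : x ∉ axis n k) :
    (axis n k)ᗮ.starProjection x ≠ 0 :=
  fun h => hx (starProjection_orthogonal_eq_zero_iff.1 h)

theorem fderiv_smul_const_of_hasFDerivAt {D V : Type*} [NormedAddCommGroup D] [NormedSpace ℝ D]
    [NormedAddCommGroup V] [NormedSpace ℝ V] {φ : D → ℝ} {φ' : D →L[ℝ] ℝ} {x : D}
    (h : HasFDerivAt φ φ' x) (b : V) : fderiv ℝ (fun x => φ x • b) x = φ'.smulRight b :=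
  (h.smul_const b).fderiv

theorem fderiv_modelMetric_apply {x : EuclideanSpace ℝ (Fin (n + 1))} (hx : x ∉ axis n k)
    (u v w : EuclideanSpace ℝ (Fin (n + 1))) :
    fderiv ℝ (modelMetric n k) x u v w =
      -(2 * (‖(axis n k)ᗮ.starProjection x‖ ^ 2)⁻¹ * inner ℝ (axialField (axis n k) x) u *
        inner ℝ v w) := by
  let B : EuclideanSpace ℝ (Fin (n + 1)) →L[ℝ] EuclideanSpace ℝ (Fin (n + 1)) →L[ℝ] ℝ := innerSL ℝ
  have hB : ∀ v w, B v w = inner ℝ v w := fun _ _ => rfl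
  have h1 := fderiv_smul_const_of_hasFDerivAt
    (hasFDerivAt_inv_norm_sq_starProjection (axis n k) (starProjection_ne_zero_of_notMem hx)) B
  have h2 : modelMetric n k = fun x => (‖(axis n k)ᗮ.starProjection x‖ ^ 2)⁻¹ • B := by
    funext x
    rw [modelMetric, inv_pow]
  rw [h2, h1]
  simp only [ContinuousLinearMap.smulRight_apply,
    smul_apply, innerSL_apply_apply, smul_eq_mul, hB,
    axialField, inner_smul_left, conj_trivial]
  ring

/-- Conformal change of the flat connection: the logarithm of the factor ‖x^⊥‖⁻² has gradient −2q.
The formula is checked against the defining equation of `christoffel`, which positivity makes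
uniquely solvable. -/
theorem christoffel_modelMetric {x : EuclideanSpace ℝ (Fin (n + 1))} (hx : x ∉ axis n k)
    (u v : EuclideanSpace ℝ (Fin (n + 1))) :
    christoffel (modelMetric n k) x u v = (inner ℝ u v : ℝ) • axialField (axis n k) x -
      (inner ℝ (axialField (axis n k) x) u : ℝ) • v -
      (inner ℝ (axialField (axis n k) x) v : ℝ) • u := by
  rw [← sub_eq_zero]
  by_contra h
  have h1 := modelMetric_pos n k hx _ h
  refine h1.ne' ?_
  rw [map_sub (modelMetric n k x), sub_apply, christoffel_spec _ _ (modelMetric_pos n k hx),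
    christoffelLower_apply]
  generalize christoffel (modelMetric n k) x u v - _ = w
  simp only [fderiv_modelMetric_apply hx, modelMetric_apply, inner_sub_left, inner_smul_left,
    conj_trivial, inv_pow]
  ring

theorem normalPart_eq_zero_iff {x : EuclideanSpace ℝ (Fin (n + 1))} (hx : x ∉ axis n k)
    (T : Submodule ℝ (EuclideanSpace ℝ (Fin (n + 1)))) (z : EuclideanSpace ℝ (Fin (n + 1))) :
    normalPart (modelMetric n k x) T z = 0 ↔ z ∈ T := by
  have h := isCompl_normalSpace (modelMetric n k x)
    (fun u v => by rw [modelMetric_apply, modelMetric_apply, real_inner_comm])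
    (modelMetric_pos n k hx) T
  rw [normalPart, dif_pos h, Submodule.projection_apply_eq_zero_iff]

theorem secondFundamentalForm_eq_zero_iff {M : Type*} [TopologicalSpace M]
    [ChartedSpace (EuclideanSpace ℝ (Fin m)) M] {f : M → EuclideanSpace ℝ (Fin (n + 1))} {p : M}
    (hp : f p ∉ axis n k) :
    (∀ u v, secondFundamentalForm m (modelMetric n k) f p u v = 0) ↔
      IsGeodesicAt (axis n k) (localRep m f p) (extChartAt (𝓡 m) p p) := by
  have hfp : localRep m f p (extChartAt (𝓡 m) p p) = f p := by
    simp [localRep]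
  refine forall₂_congr fun u v => ?_
  rw [secondFundamentalForm, normalPart_eq_zero_iff hp, christoffel_modelMetric hp, hfp,
    ← add_sub_assoc, ← add_sub_assoc, Submodule.sub_mem_iff_left, Submodule.sub_mem_iff_left]
  · exact Submodule.smul_mem _ _ ⟨v, rfl⟩
  · exact Submodule.smul_mem _ _ ⟨u, rfl⟩

theorem finrank_axis_le (hkn : k ≤ n + 1) : Module.finrank ℝ (axis n k) ≤ k - 1 := by
  let L : axis n k →ₗ[ℝ] (Fin (k - 1) → ℝ) :=
    { toFun := fun x j => (x : EuclideanSpace ℝ (Fin (n + 1))) ⟨j, by omega⟩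
      map_add' := fun _ _ => rfl
      map_smul' := fun _ _ => rfl }
  have hL : Function.Injective L := by
    intro x y hxy
    ext i
    by_cases hi : (i : ℕ) < k - 1
    · exact congrFun hxy ⟨i, hi⟩
    · rw [x.2 i (by omega), y.2 i (by omega)]
  simpa using LinearMap.finrank_le_finrank_of_injective hL

theorem starProjection_mem_orthogonal_self {E : Type*} [NormedAddCommGroup E]
    [InnerProductSpace ℝ E] [FiniteDimensional ℝ E] {K : Submodule ℝ E} {x : E} (hx : x ∈ Kᗮ) :
    Kᗮ.starProjection x = x :=
  Submodule.starProjection_eq_self_iff.2 hx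

/-- Replaces the splitting by P-invariance of the direction, based at any chosen point of `C`, such
as the centre of a sphere. -/
theorem IsSplitAffineSubspace.exists_direction {d : ℕ}
    {A C : AffineSubspace ℝ (EuclideanSpace ℝ (Fin (n + 1)))} (h : IsSplitAffineSubspace n k d A C)
    {c : EuclideanSpace ℝ (Fin (n + 1))} (hc : c ∈ C) :
    ∃ W : Submodule ℝ (EuclideanSpace ℝ (Fin (n + 1))), c ∈ axis n k ∧
      (∀ w ∈ W, (axis n k)ᗮ.starProjection w ∈ W) ∧ Module.finrank ℝ W = d ∧
      (∃ w ∈ W, w ∈ (axis n k)ᗮ ∧ w ≠ 0) ∧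
      (A : Set (EuclideanSpace ℝ (Fin (n + 1)))) = {x | x - c ∈ W} := by
  obtain ⟨l, hl1, hlk, hld, x₀, hx₀, V₁, hV₁, V₂, hV₂, hf1, hf2, rfl, rfl⟩ := h
  rw [AffineSubspace.mem_mk', vsub_eq_sub] at hc
  refine ⟨V₁ ⊔ V₂, ?_, ?_, ?_, ?_, ?_⟩
  · simpa using (axis n k).add_mem (hV₁ hc) hx₀
  · intro w hw
    obtain ⟨a, ha, b, hb, rfl⟩ := Submodule.mem_sup.1 hw
    rw [map_add, starProjection_orthogonal_eq_zero_iff.2 (hV₁ ha), zero_add,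
      starProjection_mem_orthogonal_self (hV₂ hb)]
    exact Submodule.mem_sup_right hb
  · have h1 := Submodule.finrank_sup_add_finrank_inf_eq V₁ V₂
    rw [disjoint_iff.1 ((axis n k).orthogonal_disjoint.mono hV₁ hV₂), finrank_bot, hf1, hf2] at h1
    omega
  · have h1 : V₂ ≠ ⊥ := by
      rintro rfl
      simp at hf2
    obtain ⟨v, hv, hv0⟩ := Submodule.exists_mem_ne_zero_of_ne_bot h1
    exact ⟨v, Submodule.mem_sup_right hv, hV₂ hv, hv0⟩
  · ext x
    rw [SetLike.mem_coe, AffineSubspace.mem_mk', vsub_eq_sub, Set.mem_ofPred_eq,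
      ← sub_add_sub_cancel x c x₀]
    exact Submodule.add_mem_iff_left _ (Submodule.mem_sup_left hc)

theorem isSplitAffineSubspace_mk' {d : ℕ} (hk : 1 ≤ k) (hkn : k ≤ n + 1)
    {W : Submodule ℝ (EuclideanSpace ℝ (Fin (n + 1)))} {c : EuclideanSpace ℝ (Fin (n + 1))}
    (hc : c ∈ axis n k) (hW : ∀ w ∈ W, (axis n k)ᗮ.starProjection w ∈ W)
    (hd : Module.finrank ℝ W = d) (hWK : ¬ W ≤ axis n k) :
    IsSplitAffineSubspace n k d (AffineSubspace.mk' c W) (AffineSubspace.mk' c (W ⊓ axis n k)) := by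
  have hsup : W = (W ⊓ axis n k) ⊔ (W ⊓ (axis n k)ᗮ) := by
    refine le_antisymm (fun w hw => ?_) (sup_le inf_le_left inf_le_left)
    rw [← sub_add_cancel w ((axis n k)ᗮ.starProjection w)]
    refine Submodule.add_mem_sup ⟨W.sub_mem hw (hW w hw), ?_⟩
      ⟨hW w hw, Submodule.starProjection_apply_mem _ _⟩
    rw [SetLike.mem_coe, ← starProjection_orthogonal_eq_zero_iff, map_sub,
      starProjection_mem_orthogonal_self (Submodule.starProjection_apply_mem _ _), sub_self]
  have h1 := Submodule.finrank_sup_add_finrank_inf_eq (W ⊓ axis n k) (W ⊓ (axis n k)ᗮ)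
  rw [← hsup, disjoint_iff.1 ((axis n k).orthogonal_disjoint.mono inf_le_right inf_le_right),
    finrank_bot, hd] at h1
  have h2 : 0 < Module.finrank ℝ ↥(W ⊓ (axis n k)ᗮ) := by
    rw [Nat.pos_iff_ne_zero, Ne, Submodule.finrank_eq_zero]
    intro h
    rw [h, sup_bot_eq] at hsup
    exact hWK (hsup.le.trans inf_le_right)
  have h3 : Module.finrank ℝ ↥(W ⊓ axis n k) ≤ k - 1 :=
    (Submodule.finrank_mono inf_le_right).trans (finrank_axis_le hkn)
  -- So l − 1 = dim(W ∩ K). The bound l ≤ d expresses that `W` has a nonzero part orthogonal to `K`.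
  refine ⟨Module.finrank ℝ ↥(W ⊓ axis n k) + 1, by omega, by omega, by omega, c, hc, _,
    inf_le_right, W ⊓ (axis n k)ᗮ, inf_le_right, by omega, by omega, ?_, rfl⟩
  rw [← hsup]

theorem IsModelAffine.exists_direction {S : Set (EuclideanSpace ℝ (Fin (n + 1)))}
    (h : IsModelAffine n k m S) :
    ∃ (W : Submodule ℝ (EuclideanSpace ℝ (Fin (n + 1)))) (c : _), c ∈ axis n k ∧
      (∀ w ∈ W, (axis n k)ᗮ.starProjection w ∈ W) ∧ Module.finrank ℝ W = m ∧
      (∃ w ∈ W, w ∈ (axis n k)ᗮ ∧ w ≠ 0) ∧ S = {x | x - c ∈ W} := by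
  obtain ⟨A, C, h, rfl⟩ := h
  have hc : ∃ c, c ∈ C := by
    obtain ⟨l, -, -, -, x₀, -, V₁, -, V₂, -, -, -, -, rfl⟩ := h
    exact ⟨x₀, AffineSubspace.self_mem_mk' _ _⟩
  obtain ⟨c, hc⟩ := hc
  obtain ⟨W, hW⟩ := h.exists_direction hc
  exact ⟨W, c, hW⟩

theorem IsModelSphere.exists_direction {S : Set (EuclideanSpace ℝ (Fin (n + 1)))}
    (h : IsModelSphere n k m S) :
    ∃ (W : Submodule ℝ (EuclideanSpace ℝ (Fin (n + 1)))) (c : _) (r : ℝ), c ∈ axis n k ∧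
      (∀ w ∈ W, (axis n k)ᗮ.starProjection w ∈ W) ∧ Module.finrank ℝ W = m + 1 ∧
      (∃ w ∈ W, w ∈ (axis n k)ᗮ ∧ w ≠ 0) ∧ 0 < r ∧ S = {x | x - c ∈ W ∧ ‖x - c‖ = r} := by
  obtain ⟨A, C, h, c, hc, r, hr, rfl⟩ := h
  obtain ⟨W, h1, h2, h3, h4, h5⟩ := h.exists_direction hc
  refine ⟨W, c, r, h1, h2, h3, h4, hr, ?_⟩
  rw [h5]
  ext x
  simp

theorem isModelAffine_setOf (hk : 1 ≤ k) (hkn : k ≤ n + 1)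
    {W : Submodule ℝ (EuclideanSpace ℝ (Fin (n + 1)))} {c : EuclideanSpace ℝ (Fin (n + 1))}
    (hc : c ∈ axis n k) (hW : ∀ w ∈ W, (axis n k)ᗮ.starProjection w ∈ W)
    (hd : Module.finrank ℝ W = m) (hWK : ¬ W ≤ axis n k) :
    IsModelAffine n k m {x | x - c ∈ W} :=
  ⟨_, _, isSplitAffineSubspace_mk' hk hkn hc hW hd hWK, by ext x; simp⟩

theorem isModelSphere_setOf (hk : 1 ≤ k) (hkn : k ≤ n + 1)
    {W : Submodule ℝ (EuclideanSpace ℝ (Fin (n + 1)))} {c : EuclideanSpace ℝ (Fin (n + 1))} {r : ℝ}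
    (hc : c ∈ axis n k) (hW : ∀ w ∈ W, (axis n k)ᗮ.starProjection w ∈ W)
    (hd : Module.finrank ℝ W = m + 1) (hWK : ¬ W ≤ axis n k) (hr : 0 < r) :
    IsModelSphere n k m {x | x - c ∈ W ∧ ‖x - c‖ = r} :=
  ⟨_, _, isSplitAffineSubspace_mk' hk hkn hc hW hd hWK, c, AffineSubspace.self_mem_mk' _ _, r, hr,
    by ext x; simp⟩

end Model

/-! ### From charts to the manifold. -/

section ManifoldCharts

open Filter Topology

variable {m : ℕ} {E : Type*} [NormedAddCommGroup E] [InnerProductSpace ℝ E]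
  [FiniteDimensional ℝ E] {M : Type*} [TopologicalSpace M]
  [ChartedSpace (EuclideanSpace ℝ (Fin m)) M] [IsManifold (𝓡 m) ∞ M] {f : M → E} {p : M}
  {y : EuclideanSpace ℝ (Fin m)}

theorem contMDiffAt_extChartAt_symm (hy : y ∈ (extChartAt (𝓡 m) p).target) :
    ContMDiffAt 𝓘(ℝ, EuclideanSpace ℝ (Fin m)) (𝓡 m) ∞ (extChartAt (𝓡 m) p).symm y :=
  (contMDiffOn_extChartAt_symm p).contMDiffAt ((isOpen_extChartAt_target p).mem_nhds hy)

omit [FiniteDimensional ℝ E] in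
theorem IsSmoothImmersion.contDiffAt_localRep (hf : IsSmoothImmersion m f)
    (hy : y ∈ (extChartAt (𝓡 m) p).target) : ContDiffAt ℝ ∞ (localRep m f p) y := by
  rw [← contMDiffAt_iff_contDiffAt]
  exact (hf.1 _).comp y (contMDiffAt_extChartAt_symm hy)

omit [FiniteDimensional ℝ E] in
theorem IsSmoothImmersion.injective_fderiv_localRep (hf : IsSmoothImmersion m f)
    (hy : y ∈ (extChartAt (𝓡 m) p).target) :
    Function.Injective (fderiv ℝ (localRep m f p) y) := by
  have h1 : mfderiv 𝓘(ℝ, EuclideanSpace ℝ (Fin m)) 𝓘(ℝ, E) (localRep m f p) y = _ :=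
    mfderiv_comp y ((hf.1.mdifferentiable (by simp)) ((extChartAt (𝓡 m) p).symm y))
      ((contMDiffAt_extChartAt_symm hy).mdifferentiableAt (by simp))
  rw [mfderiv_eq_fderiv] at h1
  rw [h1]
  have h2 := isInvertible_mfderivWithin_extChartAt_symm (I := 𝓡 m) hy
  rw [ModelWithCorners.range_eq_univ, mfderivWithin_univ] at h2
  exact (hf.2 _).comp h2.injective

/-- Total geodesy is tested only at the base point of each preferred chart, while the local theory
needs the equation throughout one chart; the chart at the point with coordinate `y` is used for the
transfer. -/
theorem IsSmoothImmersion.isGeodesicAt_localRep {K : Submodule ℝ E} (hf : IsSmoothImmersion m f)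
    (hg : ∀ p, IsGeodesicAt K (localRep m f p) (extChartAt (𝓡 m) p p))
    (hy : y ∈ (extChartAt (𝓡 m) p).target) : IsGeodesicAt K (localRep m f p) y := by
  set p' := (extChartAt (𝓡 m) p).symm y with hp'
  have hs := contMDiffAt_extChartAt_symm hy
  refine isGeodesicAt_of_comp (F := localRep m f p')
    (τ := extChartAt (𝓡 m) p' ∘ (extChartAt (𝓡 m) p).symm)
    (hf.contDiffAt_localRep (mem_extChartAt_target p')) ?_ ?_
    (hf.injective_fderiv_localRep hy) (hg p')
  · rw [← contMDiffAt_iff_contDiffAt]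
    exact ContMDiffAt.comp y (contMDiffAt_extChartAt (x := p')) hs
  · filter_upwards [hs.continuousAt.preimage_mem_nhds (extChartAt_source_mem_nhds (I := 𝓡 m) p')]
      with z hz
    simp only [localRep, Function.comp_apply]
    rw [(extChartAt (𝓡 m) p').left_inv hz]

omit [NormedAddCommGroup E] [InnerProductSpace ℝ E] [FiniteDimensional ℝ E]
  [IsManifold (𝓡 m) ∞ M] in
theorem eventually_of_eventually_localRep {S : Set E} {q : M}
    (hq : q ∈ (extChartAt (𝓡 m) p).source)
    (h : ∀ᶠ z in 𝓝 (extChartAt (𝓡 m) p q), localRep m f p z ∈ S) : ∀ᶠ q in 𝓝 q, f q ∈ S := by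
  filter_upwards [(continuousAt_extChartAt' hq).eventually h, extChartAt_source_mem_nhds' hq]
    with z hz hz'
  rwa [localRep, Function.comp_apply, (extChartAt (𝓡 m) p).left_inv hz'] at hz

omit [NormedAddCommGroup E] [InnerProductSpace ℝ E] [FiniteDimensional ℝ E]
  [IsManifold (𝓡 m) ∞ M] in
theorem eventually_localRep_of_eventually {S : Set E} {q : M}
    (hq : q ∈ (extChartAt (𝓡 m) p).source) (h : ∀ᶠ q in 𝓝 q, f q ∈ S) :
    ∀ᶠ z in 𝓝 (extChartAt (𝓡 m) p q), localRep m f p z ∈ S := by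
  have h1 := continuousAt_extChartAt_symm'' ((extChartAt (𝓡 m) p).map_source hq)
  rw [ContinuousAt, (extChartAt (𝓡 m) p).left_inv hq] at h1
  exact h1.eventually h

omit [FiniteDimensional ℝ E] in
/-- A closed first order contact condition that propagates in charts propagates on a connected
manifold. -/
theorem IsSmoothImmersion.forall_mem_of_contact [PreconnectedSpace M] (hf : IsSmoothImmersion m f)
    {S : Set E} {𝒞 : Set (E × (EuclideanSpace ℝ (Fin m) →L[ℝ] E))} (hC : IsClosed 𝒞)
    (h1 : ∀ p, (localRep m f p (extChartAt (𝓡 m) p p),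
        fderiv ℝ (localRep m f p) (extChartAt (𝓡 m) p p)) ∈ 𝒞 →
      ∀ᶠ z in 𝓝 (extChartAt (𝓡 m) p p), localRep m f p z ∈ S)
    (h2 : ∀ p, ∀ y ∈ (extChartAt (𝓡 m) p).target, (∀ᶠ z in 𝓝 y, localRep m f p z ∈ S) →
      (localRep m f p y, fderiv ℝ (localRep m f p) y) ∈ 𝒞)
    (p₀ : M) (h0 : (localRep m f p₀ (extChartAt (𝓡 m) p₀ p₀),
        fderiv ℝ (localRep m f p₀) (extChartAt (𝓡 m) p₀ p₀)) ∈ 𝒞) (p : M) : f p ∈ S := by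
  let O : Set M := {p | ∀ᶠ q in 𝓝 p, f q ∈ S}
  have hO : IsClopen O := by
    -- A point of the closure of `O` is a limit, in its own chart, of points of `O`. These satisfy
    -- the closed contact condition by `h2`, hence so does the limit, and `h1` puts it in `O`.
    refine ⟨isClosed_of_closure_subset fun p hp => ?_, isOpen_setOfPred_eventually_nhds⟩
    refine eventually_of_eventually_localRep (mem_extChartAt_source p) (h1 p ?_)
    have h3 := hf.contDiffAt_localRep (mem_extChartAt_target (I := 𝓡 m) p)
    have h4 : ContinuousAt (fun y => (localRep m f p y, fderiv ℝ (localRep m f p) y))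
        (extChartAt (𝓡 m) p p) :=
      h3.continuousAt.prodMk
        (h3.fderiv_right (m := ∞) (by simp)).continuousAt
    have h5 : Tendsto _ (𝓝 p) _ := h4.tendsto.comp (continuousAt_extChartAt (I := 𝓡 m) p)
    refine hC.mem_of_frequently_of_tendsto ?_ h5
    refine ((mem_closure_iff_frequently.1 hp).and_eventually
      (extChartAt_source_mem_nhds (I := 𝓡 m) p)).mono ?_
    rintro q ⟨hq, hq'⟩
    exact h2 p _ ((extChartAt (𝓡 m) p).map_source hq') (eventually_localRep_of_eventually hq' hq)
  have hp₀ : p₀ ∈ O := eventually_of_eventually_localRep (mem_extChartAt_source p₀) (h1 p₀ h0)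
  have hu := hO.eq_univ ⟨p₀, hp₀⟩
  have hp : p ∈ O := hu ▸ Set.mem_univ p
  exact Eventually.self_of_nhds (p := fun q => f q ∈ S) hp

omit [InnerProductSpace ℝ E] [FiniteDimensional ℝ E]
  [IsManifold (𝓡 m) ∞ M] in
theorem exists_isOpen_range_eq {S : Set E} (hS : ∀ p, f p ∈ S)
    (h : ∀ p, ∃ U ∈ 𝓝 (localRep m f p (extChartAt (𝓡 m) p p)),
      S ∩ U ⊆ localRep m f p '' Set.univ) :
    ∃ U, IsOpen U ∧ Set.range f = S ∩ U := by
  have hfp : ∀ p, localRep m f p (extChartAt (𝓡 m) p p) = f p := fun p => by simp [localRep]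
  simp only [hfp] at h
  choose U hU hSU using h
  refine ⟨⋃ p, interior (U p), isOpen_iUnion fun p => isOpen_interior, ?_⟩
  apply Set.Subset.antisymm
  · rintro _ ⟨p, rfl⟩
    exact ⟨hS p, Set.mem_iUnion.2 ⟨p, mem_interior_iff_mem_nhds.2 (hU p)⟩⟩
  · rintro x ⟨hx, hxU⟩
    obtain ⟨p, hp⟩ := Set.mem_iUnion.1 hxU
    obtain ⟨z, -, rfl⟩ := hSU p ⟨hx, interior_subset hp⟩
    exact ⟨_, rfl⟩

end ManifoldCharts

/-! ### The classification and its converse. -/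

section MainParts

open Filter Topology

theorem isClosed_setOf_forall_apply_mem {D E : Type*} [NormedAddCommGroup D] [NormedSpace ℝ D]
    [NormedAddCommGroup E] [NormedSpace ℝ E] [FiniteDimensional ℝ E] (T : Submodule ℝ E) :
    IsClosed {q : E × (D →L[ℝ] E) | ∀ u, q.2 u ∈ T} := by
  simp only [Set.ofPred_forall]
  exact isClosed_iInter fun u : D => T.closed_of_finiteDimensional.preimage
    (by fun_prop : Continuous fun q : E × (D →L[ℝ] E) => q.2 u)

theorem isClosed_setOf_forall_inner_eq_zero {D E : Type*} [NormedAddCommGroup D] [NormedSpace ℝ D]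
    [NormedAddCommGroup E] [InnerProductSpace ℝ E] (c : E) :
    IsClosed {q : E × (D →L[ℝ] E) | ∀ u, (inner ℝ (q.1 - c) (q.2 u) : ℝ) = 0} := by
  simpa only [Set.ofPred_forall] using isClosed_iInter fun u : D =>
    isClosed_eq (f := fun q : E × (D →L[ℝ] E) => (inner ℝ (q.1 - c) (q.2 u) : ℝ)) (by fun_prop)
      (continuous_const (y := (0 : ℝ)))

variable {n k m : ℕ}

theorem isTotallyGeodesic_of_range_subset {M : Type*} [TopologicalSpace M]
    [ChartedSpace (EuclideanSpace ℝ (Fin m)) M] [IsManifold (𝓡 m) ∞ M]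
    {f : M → EuclideanSpace ℝ (Fin (n + 1))} (hf : IsSmoothImmersion m f)
    (hfK : ∀ p, f p ∉ axis n k) {S : Set (EuclideanSpace ℝ (Fin (n + 1)))}
    (hS : IsModelAffine n k m S ∨ IsModelSphere n k m S) (hfS : Set.range f ⊆ S) :
    IsTotallyGeodesic m (modelMetric n k) f := by
  intro p
  rw [secondFundamentalForm_eq_zero_iff (hfK p)]
  have hF := hf.contDiffAt_localRep (mem_extChartAt_target (I := 𝓡 m) p)
  have hinj := hf.injective_fderiv_localRep (mem_extChartAt_target (I := 𝓡 m) p)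
  have hy : (axis n k)ᗮ.starProjection (localRep m f p (extChartAt (𝓡 m) p p)) ≠ 0 :=
    starProjection_ne_zero_of_notMem (hfK _)
  have hmem : ∀ z, localRep m f p z ∈ S := fun z => hfS ⟨_, rfl⟩
  rcases hS with hS | hS
  · obtain ⟨W, c, hc, hW, hfin, -, rfl⟩ := hS.exists_direction
    exact isGeodesicAt_of_eventually_mem_affine hF hinj hc hW (by simpa using hfin)
      (Eventually.of_forall hmem)
  · obtain ⟨W, c, r, hc, hW, hfin, -, -, rfl⟩ := hS.exists_direction
    exact isGeodesicAt_of_eventually_mem_sphere hF hinj hc hy hW (by simpa using hfin)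
      (Eventually.of_forall fun z => (hmem z).1) (Eventually.of_forall fun z => (hmem z).2)

theorem exists_model_of_isTotallyGeodesic (hk : 1 ≤ k) (hkn : k ≤ n + 1) (hm : 2 ≤ m)
    {M : Type*} [TopologicalSpace M]
    [ChartedSpace (EuclideanSpace ℝ (Fin m)) M] [IsManifold (𝓡 m) ∞ M] [ConnectedSpace M]
    {f : M → EuclideanSpace ℝ (Fin (n + 1))} (hf : IsSmoothImmersion m f)
    (hfK : ∀ p, f p ∉ axis n k) (hg : IsTotallyGeodesic m (modelMetric n k) f) :
    ∃ S, (IsModelAffine n k m S ∨ IsModelSphere n k m S) ∧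
      ∃ U, IsOpen U ∧ Set.range f = S ∩ U := by
  obtain ⟨p₀⟩ : Nonempty M := inferInstance
  have hgeo : ∀ p, ∀ y ∈ (extChartAt (𝓡 m) p).target,
      IsGeodesicAt (axis n k) (localRep m f p) y := fun p y hy =>
    hf.isGeodesicAt_localRep (fun p => (secondFundamentalForm_eq_zero_iff (hfK p)).1 (hg p)) hy
  have hgeo' : ∀ p, ∀ᶠ z in 𝓝 (extChartAt (𝓡 m) p p),
      IsGeodesicAt (axis n k) (localRep m f p) z := fun p =>
    mem_of_superset (extChartAt_target_mem_nhds (I := 𝓡 m) p) (hgeo p)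
  have hF := fun p => hf.contDiffAt_localRep (mem_extChartAt_target (I := 𝓡 m) p)
  have hinj := fun p => hf.injective_fderiv_localRep (mem_extChartAt_target (I := 𝓡 m) p)
  have hd : ∀ p, ∀ y ∈ (extChartAt (𝓡 m) p).target, DifferentiableAt ℝ (localRep m f p) y :=
    fun p y hy => (hf.contDiffAt_localRep hy).differentiableAt (by simp)
  have hne : ∀ p, (axis n k)ᗮ.starProjection (localRep m f p (extChartAt (𝓡 m) p p)) ≠ 0 :=
    fun p => starProjection_ne_zero_of_notMem (hfK _)
  have hev : ∀ {S : Set (EuclideanSpace ℝ (Fin (n + 1)))}, (∀ p, f p ∈ S) → ∀ p,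
      ∀ᶠ z in 𝓝 (extChartAt (𝓡 m) p p), localRep m f p z ∈ S :=
    fun h p => Eventually.of_forall fun z => h _
  have hcurv := starProjection_fderiv_sub_mem_range (by simpa using show 1 < m from hm) (hF p₀) (hinj p₀)
    (hne p₀) (hgeo' p₀)
  have hT : ∀ t ∈ LinearMap.range (fderiv ℝ (localRep m f p₀) (extChartAt (𝓡 m) p₀ p₀) :
      EuclideanSpace ℝ (Fin m) →ₗ[ℝ] EuclideanSpace ℝ (Fin (n + 1))),
      (axis n k)ᗮ.starProjection t -
        (inner ℝ (axialField (axis n k) (localRep m f p₀ (extChartAt (𝓡 m) p₀ p₀))) t : ℝ) •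
          (axis n k)ᗮ.starProjection (localRep m f p₀ (extChartAt (𝓡 m) p₀ p₀)) ∈
      LinearMap.range (fderiv ℝ (localRep m f p₀) (extChartAt (𝓡 m) p₀ p₀) :
        EuclideanSpace ℝ (Fin m) →ₗ[ℝ] EuclideanSpace ℝ (Fin (n + 1))) := by
    rintro _ ⟨u, rfl⟩
    exact hcurv u
  have hmemT : ∀ u, fderiv ℝ (localRep m f p₀) (extChartAt (𝓡 m) p₀ p₀) u ∈
      LinearMap.range (fderiv ℝ (localRep m f p₀) (extChartAt (𝓡 m) p₀ p₀) :
        EuclideanSpace ℝ (Fin m) →ₗ[ℝ] EuclideanSpace ℝ (Fin (n + 1))) := fun u => ⟨u, rfl⟩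
  have hfinT : Module.finrank ℝ (LinearMap.range (fderiv ℝ (localRep m f p₀)
      (extChartAt (𝓡 m) p₀ p₀) : EuclideanSpace ℝ (Fin m) →ₗ[ℝ] EuclideanSpace ℝ (Fin (n + 1)))) =
      m := by
    rw [LinearMap.finrank_range_of_inj (hinj p₀), finrank_euclideanSpace_fin]
  generalize LinearMap.range (fderiv ℝ (localRep m f p₀) (extChartAt (𝓡 m) p₀ p₀) :
        EuclideanSpace ℝ (Fin m) →ₗ[ℝ] EuclideanSpace ℝ (Fin (n + 1))) = T at hT hmemT hfinT
  have hPP : ∀ x, (axis n k)ᗮ.starProjection ((axis n k)ᗮ.starProjection x) =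
      (axis n k)ᗮ.starProjection x :=
    fun x => starProjection_mem_orthogonal_self (Submodule.starProjection_apply_mem _ _)
  -- A direction containing Px ≠ 0 is not contained in the axis, as the model subsets require.
  have hWK : ∀ {W : Submodule ℝ (EuclideanSpace ℝ (Fin (n + 1)))},
      (axis n k)ᗮ.starProjection (localRep m f p₀ (extChartAt (𝓡 m) p₀ p₀)) ∈ W →
      ¬ W ≤ axis n k := fun hw hWK => hne p₀ (by
    rw [← hPP, starProjection_orthogonal_eq_zero_iff]
    exact hWK hw)
  by_cases hw : (axis n k)ᗮ.starProjection (localRep m f p₀ (extChartAt (𝓡 m) p₀ p₀)) ∈ T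
  · have hTinv : ∀ t ∈ T, (axis n k)ᗮ.starProjection t ∈ T := fun t ht =>
      (T.sub_mem_iff_left (T.smul_mem _ hw)).1 (hT t ht)
    set c := localRep m f p₀ (extChartAt (𝓡 m) p₀ p₀) -
      (axis n k)ᗮ.starProjection (localRep m f p₀ (extChartAt (𝓡 m) p₀ p₀)) with hcdef
    have hc : c ∈ axis n k := by
      rw [← starProjection_orthogonal_eq_zero_iff, map_sub, hPP, sub_self]
    have hS : ∀ p, f p ∈ {x | x - c ∈ T} := by
      refine hf.forall_mem_of_contact (𝒞 := {q | q.1 - c ∈ T ∧ ∀ u, q.2 u ∈ T}) ?_ ?_ ?_ p₀ ?_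
      · refine IsClosed.inter (T.closed_of_finiteDimensional.preimage (by fun_prop)) ?_
        exact isClosed_setOf_forall_apply_mem T
      · rintro p ⟨h1, h2⟩
        exact eventually_sub_mem (hF p) (hinj p) (hne p) (hgeo' p) hc hTinv h1 h2
      · intro p y hy h
        exact ⟨h.self_of_nhds, fderiv_mem_of_eventually_sub_mem (hd p y hy) h⟩
      · refine ⟨?_, hmemT⟩
        rw [hcdef, sub_sub_cancel]
        exact hw
    refine ⟨_, Or.inl (isModelAffine_setOf hk hkn hc hTinv hfinT (hWK hw)),
      exists_isOpen_range_eq (m := m) hS fun p => ?_⟩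
    exact exists_nhds_inter_subset_image_affine (hF p) (hinj p) (by simpa using hfinT)
      (hev hS p) univ_mem
  · obtain ⟨c, hc, hxc, hcW, hcT⟩ := exists_center hT hw
    have hfinW := finrank_sup_span_singleton hw
    have hwW : (axis n k)ᗮ.starProjection (localRep m f p₀ (extChartAt (𝓡 m) p₀ p₀)) ∈
        T ⊔ Submodule.span ℝ
          {(axis n k)ᗮ.starProjection (localRep m f p₀ (extChartAt (𝓡 m) p₀ p₀))} :=
      Submodule.mem_sup_right (Submodule.mem_span_singleton_self _)
    have hTW : T ≤ T ⊔ Submodule.span ℝ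
          {(axis n k)ᗮ.starProjection (localRep m f p₀ (extChartAt (𝓡 m) p₀ p₀))} := le_sup_left
    have hWinv : ∀ w ∈ T ⊔ Submodule.span ℝ
          {(axis n k)ᗮ.starProjection (localRep m f p₀ (extChartAt (𝓡 m) p₀ p₀))},
        (axis n k)ᗮ.starProjection w ∈ T ⊔ Submodule.span ℝ
          {(axis n k)ᗮ.starProjection (localRep m f p₀ (extChartAt (𝓡 m) p₀ p₀))} := by
      intro w hw
      obtain ⟨t, ht, s, hs, rfl⟩ := Submodule.mem_sup.1 hw
      obtain ⟨a, rfl⟩ := Submodule.mem_span_singleton.1 hs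
      rw [map_add, map_smul, hPP]
      refine Submodule.add_mem _ ?_ (Submodule.smul_mem _ _ hwW)
      exact (Submodule.sub_mem_iff_left _ (Submodule.smul_mem _ _ hwW)).1 (hTW (hT t ht))
    rw [hfinT] at hfinW
    generalize T ⊔ Submodule.span ℝ
      {(axis n k)ᗮ.starProjection (localRep m f p₀ (extChartAt (𝓡 m) p₀ p₀))} = W at *
    set r := ‖localRep m f p₀ (extChartAt (𝓡 m) p₀ p₀) - c‖ with hr
    have hr0 : 0 < r := norm_pos_iff.2 (sub_ne_zero.2 hxc)
    have hS : ∀ p, f p ∈ {x | x - c ∈ W ∧ ‖x - c‖ = r} := by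
      refine hf.forall_mem_of_contact (𝒞 := {q | (q.1 - c ∈ W ∧ ∀ u, q.2 u ∈ W) ∧
        (‖q.1 - c‖ = r ∧ ∀ u, (inner ℝ (q.1 - c) (q.2 u) : ℝ) = 0)}) ?_ ?_ ?_ p₀ ?_
      · refine IsClosed.inter (IsClosed.inter
          (W.closed_of_finiteDimensional.preimage (by fun_prop)) ?_) (IsClosed.inter
          (isClosed_eq (by fun_prop) continuous_const) ?_)
        · exact isClosed_setOf_forall_apply_mem W
        · exact isClosed_setOf_forall_inner_eq_zero c
      · rintro p ⟨⟨h1, h2⟩, h3, h4⟩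
        refine (eventually_sub_mem (hF p) (hinj p) (hne p) (hgeo' p) hc hWinv h1 h2).and ?_
        have := eventually_norm_sub_eq (hF p) (hinj p) (hne p) (hgeo' p) hc h4
        exact this.mono fun z hz => hz.trans h3
      · intro p y hy h
        exact ⟨⟨h.self_of_nhds.1, fderiv_mem_of_eventually_sub_mem (hd p y hy)
          (h.mono fun z hz => hz.1)⟩, h.self_of_nhds.2, inner_sub_fderiv_eq_zero (hd p y hy)
          (h.mono fun z hz => hz.2)⟩
      · exact ⟨⟨hcW, fun u => hTW (hmemT u)⟩, rfl, fun u => hcT _ (hmemT u)⟩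
    refine ⟨_, Or.inr (isModelSphere_setOf hk hkn hc hWinv hfinW (hWK hwW) hr0),
      exists_isOpen_range_eq (m := m) hS fun p => ?_⟩
    exact exists_nhds_inter_subset_image_sphere (hF p) (hinj p) hr0 (by simpa using hfinW)
      ((hev hS p).mono fun z hz => hz.1) ((hev hS p).mono fun z hz => hz.2) univ_mem

end MainParts

/-! ### Embedded parametrisations of the models. -/

section Examples

open Filter Topology

theorem injective_mfderiv_subtype_val {m : ℕ} {N : Type*} [TopologicalSpace N]
    [ChartedSpace (EuclideanSpace ℝ (Fin m)) N] (U : TopologicalSpace.Opens N) (x : U) :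
    Function.Injective (mfderiv (𝓡 m) (𝓡 m) (Subtype.val : U → N) x) := by
  classical
  -- A left inverse of the inclusion. Its value off `U` is irrelevant, since it is only
  -- differentiated at a point of the open set `U`.
  let s : N → U := fun z => if h : z ∈ U then ⟨z, h⟩ else x
  have hs : ∀ z : U, s z = z := fun z => dif_pos z.2
  have h1 : ContMDiffAt (𝓡 m) (𝓡 m) ∞ s (x : N) := by
    rw [← contMDiffAt_subtype_iff]
    simp only [hs]
    exact contMDiffAt_id
  have h2 : s ∘ (Subtype.val : U → N) = id := funext hs
  have h3 := mfderiv_comp x (h1.mdifferentiableAt (by simp))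
    ((contMDiff_subtype_val (n := ∞) (I := 𝓡 m) (U := U)).mdifferentiable (by simp) x)
  rw [h2, mfderiv_id] at h3
  refine Function.LeftInverse.injective (g := mfderiv (𝓡 m) (𝓡 m) s (x : N)) fun v => ?_
  exact (congrArg (fun L : TangentSpace (𝓡 m) x →L[ℝ] TangentSpace (𝓡 m) x => L v) h3).symm

theorem IsSmoothImmersion.comp_subtype_val {m : ℕ} {E N : Type*} [NormedAddCommGroup E]
    [NormedSpace ℝ E] [TopologicalSpace N] [ChartedSpace (EuclideanSpace ℝ (Fin m)) N] {g : N → E}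
    (hg : IsSmoothImmersion m g) (U : TopologicalSpace.Opens N) :
    IsSmoothImmersion m (g ∘ (Subtype.val : U → N)) := by
  have h1 : ContMDiff (𝓡 m) (𝓡 m) ∞ (Subtype.val : U → N) := contMDiff_subtype_val
  refine ⟨hg.1.comp h1, fun x => ?_⟩
  rw [mfderiv_comp x (hg.1.mdifferentiable (by simp) _) (h1.mdifferentiable (by simp) x)]
  exact (hg.2 _).comp (injective_mfderiv_subtype_val U x)

theorem IsSmoothImmersion.postcomp {m : ℕ} {E E' N : Type*} [NormedAddCommGroup E]
    [NormedSpace ℝ E] [NormedAddCommGroup E'] [NormedSpace ℝ E'] [TopologicalSpace N]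
    [ChartedSpace (EuclideanSpace ℝ (Fin m)) N] {g : N → E}
    (hg : IsSmoothImmersion m g) (L : E →L[ℝ] E') (hL : Function.Injective L) (c : E') :
    IsSmoothImmersion m (fun x => c + L (g x)) := by
  have h1 : ContMDiff 𝓘(ℝ, E) 𝓘(ℝ, E') ∞ (fun x => c + L x) :=
    (contDiff_const.add L.contDiff).contMDiff
  refine ⟨h1.comp hg.1, fun x => ?_⟩
  have h2 : mfderiv (𝓡 m) 𝓘(ℝ, E') (fun x => c + L (g x)) x = _ :=
    mfderiv_comp (g := fun x => c + L x) x (h1.mdifferentiable (by simp) (g x)) (hg.1.mdifferentiable (by simp) x)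
  rw [h2, mfderiv_eq_fderiv, (L.hasFDerivAt.const_add c).fderiv]
  exact hL.comp (hg.2 x)

theorem isSmoothImmersion_id (m : ℕ) :
    IsSmoothImmersion m (id : EuclideanSpace ℝ (Fin m) → EuclideanSpace ℝ (Fin m)) := by
  refine ⟨contMDiff_id, fun x => ?_⟩
  have : mfderiv (𝓡 m) (𝓡 m) (id : EuclideanSpace ℝ (Fin m) → EuclideanSpace ℝ (Fin m)) x = _ :=
    mfderiv_id
  rw [this]
  exact Function.injective_id

theorem isSmoothImmersion_coe_sphere (m : ℕ) :
    haveI := Fact.mk (@finrank_euclideanSpace_fin ℝ _ (m + 1))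
    IsSmoothImmersion m
      (Subtype.val : Metric.sphere (0 : EuclideanSpace ℝ (Fin (m + 1))) 1 → _) := by
  have := Fact.mk (@finrank_euclideanSpace_fin ℝ _ (m + 1))
  exact ⟨contMDiff_coe_sphere, fun x => injective_mvfderiv_subtypeVal_sphere x⟩

variable {n k m : ℕ}

/-- The axis is closed, so its complement pulls back to an open submanifold of `N`; total geodesy
there is the converse part. -/
theorem exists_embedded_of_immersion {N : Type} [TopologicalSpace N]
    [ChartedSpace (EuclideanSpace ℝ (Fin m)) N] [IsManifold (𝓡 m) ∞ N]
    {g : N → EuclideanSpace ℝ (Fin (n + 1))} (hg : IsSmoothImmersion m g) (he : IsEmbedding g)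
    {S : Set (EuclideanSpace ℝ (Fin (n + 1)))}
    (hS : IsModelAffine n k m S ∨ IsModelSphere n k m S) (hgS : Set.range g = S)
    (hne : ∃ x ∈ S, x ∉ axis n k) :
    ∃ (M : Type) (_ : TopologicalSpace M) (_ : ChartedSpace (EuclideanSpace ℝ (Fin m)) M)
        (_ : IsManifold (𝓡 m) ∞ M) (f : M → EuclideanSpace ℝ (Fin (n + 1))),
        Nonempty M ∧ IsSmoothImmersion m f ∧ Topology.IsEmbedding f ∧
        Set.range f = S \ (axis n k : Set (EuclideanSpace ℝ (Fin (n + 1)))) ∧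
        IsTotallyGeodesic m (modelMetric n k) f := by
  let U : TopologicalSpace.Opens N := ⟨g ⁻¹' (axis n k : Set (EuclideanSpace ℝ (Fin (n + 1))))ᶜ,
    (axis n k).closed_of_finiteDimensional.isOpen_compl.preimage he.continuous⟩
  have hr : Set.range (g ∘ (Subtype.val : U → N)) =
      S \ (axis n k : Set (EuclideanSpace ℝ (Fin (n + 1)))) := by
    rw [← hgS, Set.range_comp, Subtype.range_coe]
    change g '' (g ⁻¹' (axis n k : Set (EuclideanSpace ℝ (Fin (n + 1))))ᶜ) = _
    rw [Set.image_preimage_eq_inter_range, Set.inter_comm]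
    rfl
  have himm := hg.comp_subtype_val U
  refine ⟨U, inferInstance, inferInstance, inferInstance, g ∘ Subtype.val, ?_, himm,
    he.comp IsEmbedding.subtypeVal, hr, ?_⟩
  · obtain ⟨x, hx, hxK⟩ := hne
    obtain ⟨z, rfl⟩ := hgS.symm ▸ hx
    exact ⟨⟨z, hxK⟩⟩
  · exact isTotallyGeodesic_of_range_subset himm (fun p => p.2) hS (hr ▸ Set.sdiff_subset)

theorem notMem_axis_add {c w : EuclideanSpace ℝ (Fin (n + 1))} (hc : c ∈ axis n k)
    (hw : w ∈ (axis n k)ᗮ) (hw0 : w ≠ 0) : c + w ∉ axis n k := by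
  intro h
  have h1 : w ∈ axis n k := ((axis n k).add_mem_iff_right hc).1 h
  exact hw0 (inner_self_eq_zero.1 (Submodule.inner_right_of_mem_orthogonal (𝕜 := ℝ) h1 hw))

theorem exists_embedded_affine {S : Set (EuclideanSpace ℝ (Fin (n + 1)))}
    (hS : IsModelAffine n k m S) :
    ∃ (M : Type) (_ : TopologicalSpace M) (_ : ChartedSpace (EuclideanSpace ℝ (Fin m)) M)
        (_ : IsManifold (𝓡 m) ∞ M) (f : M → EuclideanSpace ℝ (Fin (n + 1))),
        Nonempty M ∧ IsSmoothImmersion m f ∧ Topology.IsEmbedding f ∧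
        Set.range f = S \ (axis n k : Set (EuclideanSpace ℝ (Fin (n + 1)))) ∧
        IsTotallyGeodesic m (modelMetric n k) f := by
  obtain ⟨W, c, hc, hW, hfin, ⟨w, hw, hwK, hw0⟩, rfl⟩ := hS.exists_direction
  let e : EuclideanSpace ℝ (Fin m) ≃ₗᵢ[ℝ] W :=
    ((stdOrthonormalBasis ℝ W).reindex (finCongr hfin)).repr.symm
  let L : EuclideanSpace ℝ (Fin m) →ₗᵢ[ℝ] EuclideanSpace ℝ (Fin (n + 1)) :=
    W.subtypeₗᵢ.comp e.toLinearIsometry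
  have hL : ∀ x, x ∈ W ↔ ∃ z, L z = x := fun x =>
    ⟨fun hx => ⟨e.symm ⟨x, hx⟩, by simp [L]⟩, by rintro ⟨z, rfl⟩; exact (e z).2⟩
  refine exists_embedded_of_immersion (N := EuclideanSpace ℝ (Fin m)) (g := fun z => c + L z)
    ((isSmoothImmersion_id m).postcomp L.toContinuousLinearMap L.injective c)
    ((Homeomorph.addLeft c).isEmbedding.comp L.isometry.isEmbedding) (Or.inl hS) ?_
    ⟨c + w, by simpa using hw, notMem_axis_add hc hwK hw0⟩
  ext x
  rw [Set.mem_ofPred_eq, hL]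
  exact exists_congr fun z => ⟨fun h => by rw [← h, add_sub_cancel_left],
    fun h => by simp only [h, add_sub_cancel]⟩

theorem exists_embedded_sphere {S : Set (EuclideanSpace ℝ (Fin (n + 1)))}
    (hS : IsModelSphere n k m S) :
    ∃ (M : Type) (_ : TopologicalSpace M) (_ : ChartedSpace (EuclideanSpace ℝ (Fin m)) M)
        (_ : IsManifold (𝓡 m) ∞ M) (f : M → EuclideanSpace ℝ (Fin (n + 1))),
        Nonempty M ∧ IsSmoothImmersion m f ∧ Topology.IsEmbedding f ∧
        Set.range f = S \ (axis n k : Set (EuclideanSpace ℝ (Fin (n + 1)))) ∧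
        IsTotallyGeodesic m (modelMetric n k) f := by
  have := Fact.mk (@finrank_euclideanSpace_fin ℝ _ (m + 1))
  obtain ⟨W, c, r, hc, hW, hfin, ⟨w, hw, hwK, hw0⟩, hr, rfl⟩ := hS.exists_direction
  let e : EuclideanSpace ℝ (Fin (m + 1)) ≃ₗᵢ[ℝ] W :=
    ((stdOrthonormalBasis ℝ W).reindex (finCongr hfin)).repr.symm
  let L : EuclideanSpace ℝ (Fin (m + 1)) →ₗᵢ[ℝ] EuclideanSpace ℝ (Fin (n + 1)) :=
    W.subtypeₗᵢ.comp e.toLinearIsometry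
  have hL : ∀ x ∈ W, ∃ z, L z = x := fun x hx => ⟨e.symm ⟨x, hx⟩, by simp [L]⟩
  have hLW : ∀ z, L z ∈ W := fun z => (e z).2
  have hemb : IsEmbedding fun z : Metric.sphere (0 : EuclideanSpace ℝ (Fin (m + 1))) 1 =>
      c + (r • L.toContinuousLinearMap) z :=
    (Homeomorph.addLeft c).isEmbedding.comp ((Homeomorph.smulOfNeZero r hr.ne').isEmbedding.comp
      (L.isometry.isEmbedding.comp IsEmbedding.subtypeVal))
  refine exists_embedded_of_immersion
    (N := Metric.sphere (0 : EuclideanSpace ℝ (Fin (m + 1))) 1)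
    ((isSmoothImmersion_coe_sphere m).postcomp (r • L.toContinuousLinearMap) (fun a b h =>
      L.injective (smul_right_injective _ hr.ne' h)) c) hemb (Or.inr hS) ?_
    -- The point at distance `r` from `c` in a direction of `W` orthogonal to the axis, which shows
    -- that the sphere leaves the axis.
    ⟨c + (r / ‖w‖) • w, ?_, notMem_axis_add hc (Submodule.smul_mem _ _ hwK) ?_⟩
  · ext x
    constructor
    · rintro ⟨z, rfl⟩
      refine ⟨?_, ?_⟩
      · rw [add_sub_cancel_left]
        exact W.smul_mem _ (hLW _)
      · rw [add_sub_cancel_left]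
        change ‖r • L z‖ = r
        rw [norm_smul, L.norm_map, norm_eq_of_mem_sphere, mul_one, Real.norm_of_nonneg hr.le]
    · rintro ⟨hx, hxr⟩
      obtain ⟨z, hz⟩ := hL _ (W.smul_mem r⁻¹ hx)
      refine ⟨⟨z, ?_⟩, ?_⟩
      · rw [mem_sphere_zero_iff_norm, ← L.norm_map, hz, norm_smul, hxr, norm_inv,
          Real.norm_of_nonneg hr.le, inv_mul_cancel₀ hr.ne']
      · change c + r • L z = x
        rw [hz, smul_inv_smul₀ hr.ne', add_sub_cancel]
  · rw [Set.mem_ofPred_eq, add_sub_cancel_left]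
    refine ⟨W.smul_mem _ hw, ?_⟩
    rw [norm_smul, norm_div, norm_norm, div_mul_cancel₀ _ (norm_ne_zero_iff.2 hw0),
      Real.norm_of_nonneg hr.le]
  · exact smul_ne_zero (div_ne_zero hr.ne' (norm_ne_zero_iff.2 hw0)) hw0

end Examples

theorem mainTheorem11 (n k m : ℕ) (hk : 1 ≤ k) (hkn : k ≤ n + 1) (hm : 1 ≤ m) :
    -- every connected totally geodesic submanifold of dimension at least two is an open subset
    -- of a submanifold of one of the two kinds
    (∀ (M : Type*) [TopologicalSpace M] [ChartedSpace (EuclideanSpace ℝ (Fin m)) M]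
      [IsManifold (𝓡 m) ∞ M] [ConnectedSpace M] (f : M → EuclideanSpace ℝ (Fin (n + 1))),
      2 ≤ m → IsSmoothImmersion m f → (∀ p, f p ∉ axis n k) →
      IsTotallyGeodesic m (modelMetric n k) f →
      ∃ S, (IsModelAffine n k m S ∨ IsModelSphere n k m S) ∧
        ∃ U, IsOpen U ∧ Set.range f = S ∩ U) ∧
    -- conversely, every submanifold contained in a set of one of the two kinds, of the same
    -- dimension, is totally geodesic
    (∀ (M : Type*) [TopologicalSpace M] [ChartedSpace (EuclideanSpace ℝ (Fin m)) M]
      [IsManifold (𝓡 m) ∞ M] (f : M → EuclideanSpace ℝ (Fin (n + 1))),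
      IsSmoothImmersion m f → (∀ p, f p ∉ axis n k) →
      (∃ S, (IsModelAffine n k m S ∨ IsModelSphere n k m S) ∧ Set.range f ⊆ S) →
      IsTotallyGeodesic m (modelMetric n k) f) ∧
    -- each set of one of the two kinds is, outside `ℝ^{k-1}`, a nonempty embedded totally geodesic
    -- submanifold
    (∀ S, IsModelAffine n k m S ∨ IsModelSphere n k m S →
      ∃ (M : Type) (_ : TopologicalSpace M) (_ : ChartedSpace (EuclideanSpace ℝ (Fin m)) M)
        (_ : IsManifold (𝓡 m) ∞ M) (f : M → EuclideanSpace ℝ (Fin (n + 1))),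
        Nonempty M ∧ IsSmoothImmersion m f ∧ Topology.IsEmbedding f ∧
        Set.range f = S \ (axis n k : Set (EuclideanSpace ℝ (Fin (n + 1)))) ∧
        IsTotallyGeodesic m (modelMetric n k) f) := by
  refine ⟨fun M _ _ _ _ f h2 hf hfK hg => exists_model_of_isTotallyGeodesic hk hkn h2 hf hfK hg,
    fun M _ _ _ f hf hfK ⟨S, hS, hfS⟩ => isTotallyGeodesic_of_range_subset hf hfK hS hfS,
    fun S hS => ?_⟩
  rcases hS with hS | hS
  · exact exists_embedded_affine hS
  · exact exists_embedded_sphere hS
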